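/- \textbf{Setting.} Let $N\ge 0$ and let $\mathcal X_i,\mathcal Y_i,\mathcal U_i$ ($i\in[N]$) be finite alphabets. For a sequence $V_1,\dots,V_N$ write $V^{i}=(V_1,\dots,V_i)$. An \emph{$N$-node acyclic discrete network} is a collection of channels $(P_{Y_i\mid X^{i-1},Y^{i-1}})_{i\in[N]}$, where $P_{Y_i\mid X^{i-1},Y^{i-1}}$ is a conditional distribution from $\prod_{j<i}\mathcal X_j\times\prod_{j<i}\mathcal Y_j$ to $\mathcal Y_i$. A \emph{deterministic coding scheme} is a sequence of functions $f_i:\mathcal Y_i\to\mathcal X_i$, $i\in[N]$; it induces random variables $\tilde X^N,\tilde Y^N$ as follows: for $i=1,\dots,N$, $\tilde Y_i$ is generated from $P_{Y_i\mid X^{i-1},Y^{i-1}}$ given $(\tilde X^{i-1},\tilde Y^{i-1})$, and $\tilde X_i=f_i(\tilde Y_i)$. \textbf{Auxiliary and decoding-order data.} For each $i\in[N]$ let $d_i\ge 0$, let $(a_{i,j})_{j\in[d_i]}$ be a sequence of distinct indices in $[i-1]$, and let $0\le d'_i\le d_i$. For $\mathcal S\subseteq[d_i]$ put $\overline U_{i,\mathcal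 S}:=(U_{a_{i,j}})_{j\in\mathcal S}$, $\overline U_{i,k}:=U_{a_{i,k}}$ and $\overline U'_i:=\overline U_{i,[d'_i]}$. Let $(P_{U_i\mid Y_i,\overline U'_i},\,P_{X_i\mid Y_i,U_i,\overline U'_i})_{i\in[N]}$ be any conditional distributions, with $U_i\in\mathcal U_i$ and $X_i\in\mathcal X_i$. Together with the network they induce the \emph{ideal} joint distribution of $(X^N,Y^N,U^N)$: for $i=1,\dots,N$, generate $Y_i$ from $P_{Y_i\mid X^{i-1},Y^{i-1}}$, then $U_i$ from $P_{U_i\mid Y_i,\overline U'_i}$, then $X_i$ from $P_{X_i\mid Y_i,U_i,\overline U'_i}$. For random variables $V,W$ defined from $(X^N,Y^N,U^N)$, let $\iota(V;W):=\log_2\frac{P_{V\mid W}(V\mid W)}{P_V(V)}$ be their information density under the ideal distribution. For $i\in[N]$ and $j\in[d_i]$ let \[ B_{i,j}:=\gamma_{i,j}\prod_{k=j}^{d_i}\Big(2^{-\iota(\overline U_{i,k};\,\overline U_{i,[d_i]\setminus\{j,\dots,k\}},\,Y_i)+\iota(\overline U_{i,k};\,\overline U'_{a_{i,k}},\,Y_{a_{i,k}})}+\mathbf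 1\{k>j\}\Big),\qquad \gamma_{i,j}:=\prod_{k=j+1}^{d_i}\big(\ln|\mathcal U_{a_{i,k}}|+1\big). \] \textbf{Theorem.} For every acyclic discrete network, all data as above, and every set $\mathcal E\subseteq\big(\prod_{i=1}^N\mathcal X_i\big)\times\big(\prod_{i=1}^N\mathcal Y_i\big)$, there is a deterministic coding scheme $(f_i)_{i\in[N]}$ such that the induced $\tilde X^N,\tilde Y^N$ satisfy \[ \mathbf P\big((\tilde X^N,\tilde Y^N)\in\mathcal E\big)\le\mathbf E\bigg[\min\bigg\{\mathbf 1\{(X^N,Y^N)\in\mathcal E\}+\sum_{i=1}^N\sum_{j=1}^{d'_i}B_{i,j},\;1\bigg\}\bigg], \] where the expectation is with respect to the ideal distribution of $(X^N,Y^N,U^N)$. -/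

import Mathlib

/-! Acyclic discrete networks on the nodes `Fin N`, with finite alphabets.  A family `X : Fin N → Type*`
gives the alphabet of each node, and `∀ j, j < i → X j` is the type of the past `X^{i-1}` at node `i`. -/

namespace ADN

/-- A product of successive conditional distributions, summed over all sequences, is one. -/
theorem sum_prod_chain : ∀ {N : ℕ} {Z : Fin N → Type*} [∀ i, Fintype (Z i)]
    (κ : ∀ i, (∀ j, j < i → Z j) → PMF (Z i)),
    ∑ z : (∀ i, Z i), ∏ i, κ i (fun j _ => z j) (z i) = 1 := by
  intro N
  induction N with
  | zero => intro Z _ κ; simp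
  | succ n ih =>
    intro Z _ κ
    rw [← (Fin.snocEquiv Z).sum_comp, Fintype.sum_prod_type_right]
    have h := ih (Z := fun i => Z i.castSucc)
      (fun i p => κ i.castSucc (fun (j : Fin (n + 1)) hj =>
        p (j.castLT (lt_of_lt_of_le (Fin.lt_def.1 hj) (Nat.le_of_lt i.2))) hj))
    rw [← h]
    refine Finset.sum_congr rfl fun z _ => ?_
    have key : ∀ y : Z (Fin.last n),
        ∏ i, κ i (fun j _ => (Fin.snocEquiv Z) (y, z) j) ((Fin.snocEquiv Z) (y, z) i)
          = (∏ i : Fin n, κ i.castSucc (fun (j : Fin (n + 1)) hj =>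
              z (j.castLT (lt_of_lt_of_le (Fin.lt_def.1 hj) (Nat.le_of_lt i.2)))) (z i))
            * κ (Fin.last n) (fun (j : Fin (n + 1)) hj => z (j.castLT (Fin.lt_def.1 hj))) y := by
      intro y
      rw [Fin.prod_univ_castSucc]
      congr 1
      · refine Finset.prod_congr rfl fun i _ => ?_
        have h1 : (fun j (_ : j < i.castSucc) => (Fin.snocEquiv Z) (y, z) j)
            = (fun (j : Fin (n + 1)) hj =>
              z (j.castLT (lt_of_lt_of_le (Fin.lt_def.1 hj) (Nat.le_of_lt i.2)))) := by
          funext j hj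
          exact Fin.snoc_castSucc (α := Z) y z
            (j.castLT (lt_of_lt_of_le (Fin.lt_def.1 hj) (Nat.le_of_lt i.2)))
        rw [h1]
        congr 1
        exact Fin.snoc_castSucc (α := Z) y z i
      · have h1 : (fun j (_ : j < Fin.last n) => (Fin.snocEquiv Z) (y, z) j)
            = (fun (j : Fin (n + 1)) hj => z (j.castLT (Fin.lt_def.1 hj))) := by
          funext j hj
          exact Fin.snoc_castSucc (α := Z) y z (j.castLT (Fin.lt_def.1 hj))
        rw [h1]
        congr 1
        exact Fin.snoc_last (α := Z) y z
    simp_rw [key]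
    rw [← Finset.mul_sum]
    have h2 : ∀ p : PMF (Z (Fin.last n)), ∑ y, p y = 1 := fun p => by
      rw [← tsum_fintype (L := .unconditional _)]; exact p.tsum_coe
    rw [h2, mul_one]

/-- The joint law of `Z_1, …, Z_N` when, successively, `Z_i` is drawn from `κ i` given
`Z_1, …, Z_{i-1}`. -/
noncomputable def chainLaw {N : ℕ} {Z : Fin N → Type*} [∀ i, Fintype (Z i)]
    (κ : ∀ i, (∀ j, j < i → Z j) → PMF (Z i)) : PMF (∀ i, Z i) :=
  PMF.ofFintype (fun z => ∏ i, κ i (fun j _ => z j) (z i)) (sum_prod_chain κ)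

/-- An `N`-node acyclic discrete network: the channels `P_{Y_i | X^{i-1}, Y^{i-1}}`. -/
abbrev Network {N : ℕ} (X Y : Fin N → Type*) : Type _ :=
  ∀ i, (∀ j, j < i → X j) → (∀ j, j < i → Y j) → PMF (Y i)

/-- A deterministic coding scheme: encoding functions `f_i : 𝒴_i → 𝒳_i`. -/
abbrev DeterministicScheme {N : ℕ} (X Y : Fin N → Type*) : Type _ :=
  ∀ i, Y i → X i

/-- The law of `(X̃_i, Ỹ_i)_i` under a deterministic scheme: successively, `Ỹ_i` is drawn from the
channel given `X̃^{i-1}, Ỹ^{i-1}`, and `X̃_i = f_i(Ỹ_i)`. -/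
noncomputable def schemeLaw {N : ℕ} {X Y : Fin N → Type*} [∀ i, Fintype (X i)]
    [∀ i, Fintype (Y i)] (P : Network X Y) (f : DeterministicScheme X Y) :
    PMF (∀ i, X i × Y i) :=
  chainLaw fun i past =>
    (P i (fun j hj => (past j hj).1) (fun j hj => (past j hj).2)).map fun y => (f i y, y)

/-- The data of which auxiliaries each node decodes, and in which order: for each node `i`, distinct
indices `a_{i,1}, …, a_{i,d_i}` of earlier nodes, of which the first `d'_i` are decoded uniquely. -/
structure DecodingOrder (N : ℕ) where
  d : Fin N → ℕ
  a : ∀ i, Fin (d i) → Fin N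
  a_lt : ∀ i j, a i j < i
  a_injective : ∀ i, Function.Injective (a i)
  d' : Fin N → ℕ
  d'_le : ∀ i, d' i ≤ d i

/-- The index set `[d'_i] ⊆ [d_i]`. -/
def DecodingOrder.unique {N : ℕ} (D : DecodingOrder N) (i : Fin N) : Finset (Fin (D.d i)) :=
  Finset.univ.filter fun j => (j : ℕ) < D.d' i

/-- The alphabet of `Ū_{i,S} = (U_{a_{i,j}})_{j ∈ S}`, for `S ⊆ [d_i]`. -/
abbrev DecodingOrder.UBar {N : ℕ} (D : DecodingOrder N) (U : Fin N → Type*) (i : Fin N)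
    (S : Finset (Fin (D.d i))) : Type _ :=
  ∀ j : S, U (D.a i j)

/-- The conditional distributions `P_{U_i | Y_i, Ū'_i}` and `P_{X_i | Y_i, U_i, Ū'_i}`, where
`Ū'_i = Ū_{i,[d'_i]}`. -/
structure Auxiliary {N : ℕ} (X Y U : Fin N → Type*) (D : DecodingOrder N) where
  pU : ∀ i, Y i → D.UBar U i (D.unique i) → PMF (U i)
  pX : ∀ i, Y i → U i → D.UBar U i (D.unique i) → PMF (X i)

section Ideal

variable {N : ℕ} {X Y U : Fin N → Type*}

/-- A value of `(X_i, Y_i, U_i)_i`. -/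
abbrev Outcome (X Y U : Fin N → Type*) : Type _ := ∀ i, X i × Y i × U i

/-- The coordinate `X^N`. -/
abbrev Outcome.x (ω : Outcome X Y U) (i : Fin N) : X i := (ω i).1

/-- The coordinate `Y^N`. -/
abbrev Outcome.y (ω : Outcome X Y U) (i : Fin N) : Y i := (ω i).2.1

/-- The coordinate `U^N`. -/
abbrev Outcome.u (ω : Outcome X Y U) (i : Fin N) : U i := (ω i).2.2

/-- The random variable `Ū_{i,S} = (U_{a_{i,j}})_{j ∈ S}`. -/
def Outcome.uBar (ω : Outcome X Y U) (D : DecodingOrder N) (i : Fin N)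
    (S : Finset (Fin (D.d i))) : D.UBar U i S :=
  fun j => Outcome.u ω (D.a i j)

variable [∀ i, Fintype (X i)] [∀ i, Fintype (Y i)] [∀ i, Fintype (U i)]

/-- The ideal distribution of `(X_i, Y_i, U_i)_i`: successively, `Y_i` is drawn from the channel
given `X^{i-1}, Y^{i-1}`, then `U_i` from `P_{U_i | Y_i, Ū'_i}`, then `X_i` from
`P_{X_i | Y_i, U_i, Ū'_i}`. -/
noncomputable def idealLaw (P : Network X Y) (D : DecodingOrder N) (A : Auxiliary X Y U D) :
    PMF (Outcome X Y U) :=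
  chainLaw fun i past =>
    let u' : D.UBar U i (D.unique i) := fun j => (past (D.a i j) (D.a_lt i j)).2.2
    (P i (fun j hj => (past j hj).1) (fun j hj => (past j hj).2.1)).bind fun y =>
      (A.pU i y u').bind fun u =>
        (A.pX i y u u').map fun x => (x, y, u)

/-- The information density `ι(V;W) = log₂ (P_{V|W}(V|W) / P_V(V))` of two random variables on a
discrete probability space, as a function of the outcome. -/
noncomputable def infoDensity {Ω α β : Type*} (p : PMF Ω) (V : Ω → α) (W : Ω → β) (ω : Ω) : ℝ :=
  Real.logb 2
    (((p.map fun ω => (V ω, W ω)) (V ω, W ω)).toReal / ((p.map W) (W ω)).toReal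
      / ((p.map V) (V ω)).toReal)

/-- `γ_{i,j} = ∏_{k=j+1}^{d_i} (ln |𝒰_{a_{i,k}}| + 1)`. -/
noncomputable def gammaTerm (U : Fin N → Type*) [∀ i, Fintype (U i)] (D : DecodingOrder N)
    (i : Fin N) (j : Fin (D.d i)) : ℝ :=
  ∏ k ∈ Finset.Ioi j, (Real.log (Fintype.card (U (D.a i k))) + 1)

/-- The random variable `B_{i,j}`, where `p` is the law of `(X_i, Y_i, U_i)_i`. -/
noncomputable def bTerm (p : PMF (Outcome X Y U)) (D : DecodingOrder N) (i : Fin N)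
    (j : Fin (D.d i)) (ω : Outcome X Y U) : ℝ :=
  gammaTerm U D i j *
    ∏ k ∈ Finset.Ici j,
      ((2 : ℝ) ^
          (- infoDensity p (fun ω => Outcome.u ω (D.a i k))
                (fun ω => (Outcome.uBar ω D i (Finset.Icc j k)ᶜ, Outcome.y ω i)) ω
            + infoDensity p (fun ω => Outcome.u ω (D.a i k))
                (fun ω => (Outcome.uBar ω D (D.a i k) (D.unique (D.a i k)),
                  Outcome.y ω (D.a i k))) ω)
        + if j < k then 1 else 0)

end Ideal

/-- The probability of an event under a discrete law. -/
noncomputable def prob {Ω : Type*} (p : PMF Ω) (S : Set Ω) : ℝ :=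
  (p.toOuterMeasure S).toReal

/-- The expectation of a real random variable on a finite probability space. -/
noncomputable def expect {Ω : Type*} [Fintype Ω] (p : PMF Ω) (g : Ω → ℝ) : ℝ :=
  ∑ ω, (p ω).toReal * g ω

end ADN

/-! Every node carries independent Exp(1) marks `z`, one for each value of `U_l` and one for each
value of `X_l`. Under weights `q` the value maximizing `q v / z v` wins the race, which happens to
`u` with probability at most `q u` (`raceMeasure_wins_le`). Encoders draw `U_l` and `X_l` as winners
under their kernels; node `i` recovers its `U_{a_{i,j}}` successively by racing the same marks under
its own weights. The crux is the matching bound `lintegral_wins_mul_card_rivals_le`: when `u` wins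
under `p`, the count of values not behind it under `q` has mean at most `p u / q u`, up to the
factor `p u` for winning. Without such a rival the two winners agree.

Coordinate `j` must be decoded before the later ones are known. `decodeWeight` is a sum over all
tuples of a product of sub-probability weights: coordinates before `j` are frozen at their decoded
values, `j` has its conditional law, and each `k > j` is weighted by its inverse rank in the race
under its conditional law, divided by `ln |U| + 1`, which dominates the harmonic sum of inverse
ranks. The conditioning is on coordinates before `j` and after `k`, so the product is a chain
running from the last coordinate down (`sum_prod_revChain_le`). Keeping only the true tuple bounds
the weight from below, hence the matching ratio by a ratio for `j` times ranks for `k > j`. A rank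
is one plus a rival count, so by the matching bound again its mean is at most a ratio plus one.
These are exactly the factors of `B_{i,j}` (`stepError_le`, `bTerm_eq`). Independence comes from the
distinctness of the indices `a_{i,k}`.

Everything is done for a fixed outcome: being selected by the marks lies in a product event over the
nodes, of probability at most the product of the encoding kernels, and a decoding error costs a
further factor `B_{i,j}`. For fixed marks the scheme is deterministic, and it reproduces the
selected outcome unless some decoding fails (`schemeLaw_markedScheme_le`). Summing over outcomes and
choosing marks no worse than average (`exists_marks_le`) finishes the proof. -/

set_option linter.unusedSectionVars false

/-! ### Integrals over product measures and against the exponential law -/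

namespace ADN

open MeasureTheory ProbabilityTheory Finset
open scoped ENNReal

/-- Integrating out one coordinate of a product of probability measures beforehand does not change
the integral. -/
theorem lintegral_pi_update {ι : Type*} [Fintype ι] [DecidableEq ι] {Ω : ι → Type*}
    [∀ i, MeasurableSpace (Ω i)] (μ : ∀ i, Measure (Ω i)) [∀ i, IsProbabilityMeasure (μ i)] (i : ι)
    {f : (∀ i, Ω i) → ℝ≥0∞} (hf : Measurable f) :
    ∫⁻ x, f x ∂Measure.pi μ = ∫⁻ x, ∫⁻ t, f (Function.update x i t) ∂μ i ∂Measure.pi μ := by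
  obtain ⟨x₀⟩ : Nonempty (∀ i, Ω i) := (Measure.pi μ).nonempty_of_neZero
  have hg : Measurable fun x => ∫⁻ t, f (Function.update x i t) ∂μ i := by
    have := hf.lmarginal (μ := μ) (s := {i})
    rwa [lmarginal_singleton] at this
  rw [lintegral_eq_lmarginal_univ x₀, lmarginal_erase' _ hf (mem_univ i),
    lintegral_eq_lmarginal_univ (μ := μ) x₀, lmarginal_erase' _ hg (mem_univ i)]
  simp

/-- The integral of a product of functions of the single coordinates is the product of their
integrals. -/
theorem lintegral_pi_prod {ι : Type*} [Fintype ι] {Ω : ι → Type*}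
    [∀ i, MeasurableSpace (Ω i)] (μ : ∀ i, Measure (Ω i)) [∀ i, IsProbabilityMeasure (μ i)]
    {f : ∀ i, Ω i → ℝ≥0∞} (hf : ∀ i, Measurable (f i)) :
    ∫⁻ x, ∏ i, f i (x i) ∂Measure.pi μ = ∏ i, ∫⁻ t, f i t ∂μ i := by
  have h := lintegral_prod_eq_prod_lintegral_of_indepFun (μ := Measure.pi μ) univ
    (fun i (x : ∀ i, Ω i) => f i (x i)) (iIndepFun_pi fun i => (hf i).aemeasurable)
    fun i => (hf i).comp (measurable_pi_apply i)
  rw [h]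
  refine prod_congr rfl fun i _ => ?_
  exact (measurePreserving_eval μ i).lintegral_comp (hf i)

instance : IsProbabilityMeasure (expMeasure 1) := isProbabilityMeasure_expMeasure one_pos

theorem measurable_exponentialPDF : Measurable (exponentialPDF 1) :=
  (measurable_exponentialPDFReal 1).ennreal_ofReal

theorem expMeasure_one_eq : expMeasure 1 = volume.withDensity (exponentialPDF 1) := rfl

theorem ae_expMeasure_pos : ∀ᵐ t ∂expMeasure 1, 0 < t := by
  have h : expMeasure 1 (Set.Iic 0) = 0 := by
    rw [expMeasure_one_eq, withDensity_apply _ measurableSet_Iic,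
      setLIntegral_congr (Iio_ae_eq_Iic (a := (0 : ℝ))).symm]
    exact lintegral_exponentialPDF_of_nonpos le_rfl
  rw [ae_iff]
  simp only [not_lt]
  exact h

theorem lintegral_expMeasure {f : ℝ → ℝ≥0∞} (hf : Measurable f) :
    ∫⁻ t, f t ∂expMeasure 1 = ∫⁻ t, exponentialPDF 1 t * f t := by
  rw [expMeasure_one_eq, lintegral_withDensity_eq_lintegral_mul _ measurable_exponentialPDF hf]
  rfl

/-- Together with the density `e^{-t}` the integrand is `e^{-t/c}`, a multiple of a Gamma density.
It is used with `c = p u`: when `u` has mark `t`, all competitors stay behind with probability at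
most `e^{-(1/c - 1)t}`. -/
theorem lintegral_exp_neg_expMeasure {c : ℝ} (hc : 0 < c) :
    ∫⁻ t, ENNReal.ofReal (Real.exp (-((c⁻¹ - 1) * t))) ∂expMeasure 1 = ENNReal.ofReal c := by
  have hc' : 0 < c⁻¹ := inv_pos.2 hc
  rw [lintegral_expMeasure (by fun_prop)]
  have h : ∀ t, exponentialPDF 1 t * ENNReal.ofReal (Real.exp (-((c⁻¹ - 1) * t)))
      = ENNReal.ofReal c * gammaPDF 1 c⁻¹ t := by
    intro t
    rw [exponentialPDF_eq, gammaPDF_eq, ← ENNReal.ofReal_mul hc.le,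
      ← ENNReal.ofReal_mul' (by positivity)]
    split_ifs with ht
    · congr 1
      have : Real.exp (-(c⁻¹ * t)) = Real.exp (-(1 * t)) * Real.exp (-((c⁻¹ - 1) * t)) := by
        rw [← Real.exp_add]; ring_nf
      simp [this]
      field_simp
    · simp
  simp_rw [h]
  rw [lintegral_const_mul' _ _ ENNReal.ofReal_ne_top, lintegral_gammaPDF_eq_one one_pos hc',
    mul_one]

/-- The extra factor `t`, which will come from confining one competitor's mark to an interval of
length at most proportional to `t`, turns the Gamma density of shape 1 into that of shape 2. -/
theorem lintegral_mul_exp_neg_expMeasure {c : ℝ} (hc : 0 < c) :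
    ∫⁻ t, ENNReal.ofReal (t * Real.exp (-((c⁻¹ - 1) * t))) ∂expMeasure 1
      = ENNReal.ofReal (c ^ 2) := by
  have hc' : 0 < c⁻¹ := inv_pos.2 hc
  rw [lintegral_expMeasure (by fun_prop)]
  have h : ∀ t, exponentialPDF 1 t * ENNReal.ofReal (t * Real.exp (-((c⁻¹ - 1) * t)))
      = ENNReal.ofReal (c ^ 2) * gammaPDF 2 c⁻¹ t := by
    intro t
    rw [exponentialPDF_eq, gammaPDF_eq, ← ENNReal.ofReal_mul (by positivity)]
    split_ifs with ht
    · rw [← ENNReal.ofReal_mul' (by positivity)]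
      congr 1
      have : Real.exp (-(c⁻¹ * t)) = Real.exp (-(1 * t)) * Real.exp (-((c⁻¹ - 1) * t)) := by
        rw [← Real.exp_add]; ring_nf
      have h2 : (2 : ℝ) - 1 = 1 := by norm_num
      simp [this, h2]
      field_simp
    · simp
  simp_rw [h]
  rw [lintegral_const_mul' _ _ ENNReal.ofReal_ne_top, lintegral_gammaPDF_eq_one two_pos hc',
    mul_one]

theorem expMeasure_Ici_le {a : ℝ} (ha : 0 ≤ a) :
    expMeasure 1 (Set.Ici a) ≤ ENNReal.ofReal (Real.exp (-a)) := by
  have h1 : expMeasure 1 (Set.Ici a) = 1 - expMeasure 1 (Set.Iic a) := by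
    rw [← prob_compl_eq_one_sub measurableSet_Iic, Set.compl_Iic]
    refine measure_congr ?_
    have : expMeasure 1 ≪ volume := withDensity_absolutelyContinuous _ _
    exact (this.ae_eq Ioi_ae_eq_Ici).symm
  have h2 : expMeasure 1 (Set.Iic a) = ENNReal.ofReal (1 - Real.exp (-a)) := by
    have := cdf_expMeasure_eq one_pos a
    rw [cdf_eq_real, if_pos ha, one_mul] at this
    rw [← this, ofReal_measureReal]
  rw [h1, h2, ← ENNReal.ofReal_one, ← ENNReal.ofReal_sub _ (by simpa using ha)]
  simp

/-- The density is at most its value at `a`, and the length is relaxed to `b`. Keeping the factor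
`e^{-a}` lets a rival contribute the same exponential as any other competitor. -/
theorem expMeasure_Icc_le {a b : ℝ} (ha : 0 ≤ a) :
    expMeasure 1 (Set.Icc a b) ≤ ENNReal.ofReal (Real.exp (-a)) * ENNReal.ofReal b := by
  rw [expMeasure_one_eq, withDensity_apply _ measurableSet_Icc]
  calc ∫⁻ t in Set.Icc a b, exponentialPDF 1 t
      ≤ ∫⁻ _ in Set.Icc a b, ENNReal.ofReal (Real.exp (-a)) := by
        refine setLIntegral_mono measurable_const fun t ht => ?_
        rw [exponentialPDF_of_nonneg (ha.trans ht.1)]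
        refine ENNReal.ofReal_le_ofReal ?_
        simpa using ht.1
    _ = ENNReal.ofReal (Real.exp (-a)) * ENNReal.ofReal (b - a) := by simp
    _ ≤ _ := by gcongr; linarith

end ADN

/-! ### Exponential races and the matching bound -/

namespace ADN

open MeasureTheory ProbabilityTheory Finset
open scoped ENNReal

section Race

variable {α : Type*}

/-- The element `u` wins the race with weights `q` and arrival marks `z`. -/
def Wins (q z : α → ℝ) (u : α) : Prop := ∀ v, q v / z v ≤ q u / z u

theorem exists_wins [Finite α] [Nonempty α] (q z : α → ℝ) : ∃ u, Wins q z u :=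
  Finite.exists_max fun v => q v / z v

theorem Wins.lt_of_update [DecidableEq α] {p x : α → ℝ} {u w : α} {t : ℝ} (ht : 0 < t)
    (hu : 0 < p u) (hx : ∀ v, 0 < x v) (hw : w ≠ u) (h : Wins p (Function.update x u t) u) :
    t * p w / p u ≤ x w := by
  have h1 := h w
  rw [Function.update_self, Function.update_of_ne hw, div_le_div_iff₀ (hx w) ht] at h1
  rw [div_le_iff₀ hu]
  linarith

open Classical in
theorem sum_inv_card_rivals_le_harmonic (s : α → ℝ) (t : Finset α) :
    ∑ u ∈ t, (((t.filter fun v => v ≠ u ∧ s u ≤ s v).card : ℝ) + 1)⁻¹ ≤ harmonic t.card := by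
  induction hn : t.card generalizing t with
  | zero => simp [card_eq_zero.1 hn]
  | succ n ih =>
    -- The lowest score has all the others as rivals, hence the term `1/(n+1)`; deleting it can only
    -- shrink the rival sets of the rest.
    obtain ⟨m, hm, hmin⟩ := t.exists_min_image s (card_pos.1 (by omega))
    have h1 : t.filter (fun v => v ≠ m ∧ s m ≤ s v) = t.erase m := by
      ext v
      simp only [mem_filter, mem_erase]
      exact ⟨fun h => ⟨h.2.1, h.1⟩, fun h => ⟨h.2, h.1, hmin v h.2⟩⟩
    have h2 : (t.erase m).card = n := by rw [card_erase_of_mem hm, hn]; rfl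
    rw [← sum_erase_add _ _ hm, h1, h2, harmonic_succ]
    push_cast
    gcongr
    refine le_trans (sum_le_sum fun u _ => ?_) (ih _ h2)
    gcongr
    exact erase_subset _ _

theorem measurableSet_div_le_div (q : α → ℝ) (u v : α) :
    MeasurableSet {z : α → ℝ | q u / z u ≤ q v / z v} :=
  measurableSet_le (by fun_prop) (by fun_prop)

variable [Fintype α]

open Classical in
/-- The competitors of `u` that are not behind `u` in the race with weights `q` and marks `z`. -/
noncomputable def rivals (q z : α → ℝ) (u : α) : Finset α :=
  {v | v ≠ u ∧ q u / z u ≤ q v / z v}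

/-- Independent exponential marks. -/
noncomputable def raceMeasure (α : Type*) [Fintype α] : Measure (α → ℝ) :=
  Measure.pi fun _ => expMeasure 1

instance : IsProbabilityMeasure (raceMeasure α) := by
  unfold raceMeasure; infer_instance

theorem measurableSet_wins (q : α → ℝ) (u : α) : MeasurableSet {z | Wins q z u} := by
  simp only [Wins, Set.ofPred_forall]
  exact MeasurableSet.iInter fun v => measurableSet_div_le_div q v u

theorem ae_raceMeasure_pos : ∀ᵐ z ∂raceMeasure α, ∀ v, 0 < z v := by
  rw [eventually_countable_forall]
  intro v
  exact (measurePreserving_eval (fun _ : α => expMeasure 1) v).quasiMeasurePreserving.ae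
    ae_expMeasure_pos

-- Conditioning on the mark `t` of `u` leaves the other marks independent, so coordinatewise
-- necessary conditions for `A` give a product. Null sets take care of nonpositive marks.
open Classical in
theorem raceMeasure_le_lintegral {A : Set (α → ℝ)} (hA : MeasurableSet A) (u : α)
    (S : ℝ → α → Set ℝ)
    (h : ∀ x t, 0 < t → (∀ v, 0 < x v) → Function.update x u t ∈ A → ∀ w, w ≠ u → x w ∈ S t w) :
    raceMeasure α A ≤ ∫⁻ t, ∏ w ∈ univ.erase u, expMeasure 1 (S t w) ∂expMeasure 1 := by
  have hm : Measurable fun p : (α → ℝ) × ℝ => A.indicator (1 : (α → ℝ) → ℝ≥0∞)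
      (Function.update p.1 u p.2) :=
    (measurable_one.indicator hA).comp measurable_update'
  rw [← lintegral_indicator_one hA, raceMeasure,
    lintegral_pi_update (fun _ : α => expMeasure 1) u (measurable_one.indicator hA),
    lintegral_lintegral_swap hm.aemeasurable]
  refine lintegral_mono_ae ?_
  filter_upwards [ae_expMeasure_pos] with t ht
  have hB : MeasurableSet {x : α → ℝ | Function.update x u t ∈ A} :=
    measurable_update_left hA
  calc ∫⁻ x, A.indicator (1 : (α → ℝ) → ℝ≥0∞) (Function.update x u t)
        ∂Measure.pi (fun _ => expMeasure 1)
      = Measure.pi (fun _ => expMeasure 1) {x : α → ℝ | Function.update x u t ∈ A} := by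
        rw [← lintegral_indicator_one hB]; rfl
    _ ≤ Measure.pi (fun _ => expMeasure 1)
          (Set.univ.pi fun w => if w = u then Set.univ else S t w) := by
        refine measure_mono_ae ?_
        filter_upwards [ae_raceMeasure_pos (α := α)] with x hx hxA w _
        by_cases hw : w = u
        · simp [hw]
        · simpa [hw] using h x t ht hx hxA w hw
    _ = ∏ w ∈ univ.erase u, expMeasure 1 (S t w) := by
        rw [Measure.pi_pi, ← mul_prod_erase univ _ (mem_univ u)]
        simp only [↓reduceIte, measure_univ, one_mul]
        exact prod_congr rfl fun w hw => by simp [ne_of_mem_erase hw]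

open Classical in
theorem prod_exp_neg_ratio {p : α → ℝ} (hp1 : ∑ v, p v = 1) {u : α} (hu : 0 < p u) (t : ℝ) :
    ∏ w ∈ univ.erase u, ENNReal.ofReal (Real.exp (-(t * p w / p u)))
      = ENNReal.ofReal (Real.exp (-(((p u)⁻¹ - 1) * t))) := by
  rw [← ENNReal.ofReal_prod_of_nonneg fun _ _ => (Real.exp_pos _).le, ← Real.exp_sum]
  congr 2
  rw [sum_neg_distrib, ← sum_div, ← mul_sum]
  have : ∑ w ∈ univ.erase u, p w = 1 - p u := by
    rw [← hp1, ← add_sum_erase univ p (mem_univ u)]; ring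
  rw [this]
  field_simp

/-- Some value has positive weight, and for positive marks its score is positive, while that of `u`
is zero. -/
theorem raceMeasure_wins_eq_zero {p : α → ℝ} (hp : ∀ v, 0 ≤ p v) (hp1 : ∑ v, p v = 1) {u : α}
    (hu : p u = 0) : raceMeasure α {z | Wins p z u} = 0 := by
  obtain ⟨v, hv⟩ : ∃ v, 0 < p v := by
    by_contra! hc
    rw [sum_eq_zero fun v _ => le_antisymm (hc v) (hp v)] at hp1
    exact zero_ne_one hp1
  rw [measure_eq_zero_iff_ae_notMem]
  filter_upwards [ae_raceMeasure_pos (α := α)] with z hz hw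
  have := hw v
  rw [hu, zero_div] at this
  exact absurd (div_pos hv (hz v)) (not_lt.2 this)

/-- The probability of winning the race is at most the weight. -/
theorem raceMeasure_wins_le {p : α → ℝ} (hp : ∀ v, 0 ≤ p v) (hp1 : ∑ v, p v = 1) (u : α) :
    raceMeasure α {z | Wins p z u} ≤ ENNReal.ofReal (p u) := by
  classical
  rcases (hp u).eq_or_lt with hu | hu
  · rw [raceMeasure_wins_eq_zero hp hp1 hu.symm]; exact zero_le
  refine (raceMeasure_le_lintegral (measurableSet_wins p u) u (fun t w => Set.Ici (t * p w / p u))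
    fun x t ht hx hA w hw => Wins.lt_of_update ht hu hx hw hA).trans ?_
  rw [← lintegral_exp_neg_expMeasure hu]
  refine lintegral_mono_ae ?_
  filter_upwards [ae_expMeasure_pos] with t ht
  rw [← prod_exp_neg_ratio hp1 hu]
  exact prod_le_prod' fun w _ => expMeasure_Ici_le (div_nonneg (mul_nonneg ht.le (hp w)) hu.le)

/-- If `u` has mark `t`, winning forces every other mark `x w ≥ t p w / p u`, and `v` being a rival
forces `x v ≤ t q v / q u`. The first conditions contribute `e^{-(1/p u - 1)t}`, the last one a
factor linear in `t`; the shape-2 Gamma integral then yields `(p u)^2 q v / q u`. -/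
theorem raceMeasure_wins_inter_le {p q : α → ℝ} (hp : ∀ v, 0 ≤ p v) (hp1 : ∑ v, p v = 1) {u v : α}
    (huv : v ≠ u) (hu : 0 < p u) (hq : 0 < q u) (hqv : 0 ≤ q v) :
    raceMeasure α ({z | Wins p z u} ∩ {z | q u / z u ≤ q v / z v})
      ≤ ENNReal.ofReal (p u ^ 2) * ENNReal.ofReal (q v / q u) := by
  classical
  refine (raceMeasure_le_lintegral ((measurableSet_wins p u).inter (measurableSet_div_le_div q u v)) u
    (fun t w => if w = v then Set.Icc (t * p w / p u) (t * q v / q u) else Set.Ici (t * p w / p u))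
    fun x t ht hx hA w hw => ?_).trans ?_
  · have h1 := Wins.lt_of_update ht hu hx hw hA.1
    split_ifs with h
    · subst h
      refine ⟨h1, ?_⟩
      have h2 : q u / Function.update x u t u ≤ q w / Function.update x u t w := hA.2
      rw [Function.update_self, Function.update_of_ne hw, div_le_div_iff₀ ht (hx w)] at h2
      rw [le_div_iff₀ hq]
      linarith
    · exact h1
  rw [← lintegral_mul_exp_neg_expMeasure hu, ← lintegral_mul_const _ (by fun_prop)]
  refine lintegral_mono_ae ?_
  filter_upwards [ae_expMeasure_pos] with t ht
  calc _ ≤ ∏ w ∈ univ.erase u, ENNReal.ofReal (Real.exp (-(t * p w / p u)))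
            * (if w = v then ENNReal.ofReal (t * q v / q u) else 1) := by
        refine prod_le_prod' fun w _ => ?_
        have h0 : 0 ≤ t * p w / p u := div_nonneg (mul_nonneg ht.le (hp w)) hu.le
        split_ifs with h
        · exact expMeasure_Icc_le h0
        · rw [mul_one]; exact expMeasure_Ici_le h0
    _ = ENNReal.ofReal (Real.exp (-(((p u)⁻¹ - 1) * t))) * ENNReal.ofReal (t * q v / q u) := by
        rw [prod_mul_distrib, prod_exp_neg_ratio hp1 hu, prod_ite_eq', if_pos (by simp [huv])]
    _ = _ := by
        rw [← ENNReal.ofReal_mul (Real.exp_pos _).le,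
          ← ENNReal.ofReal_mul (mul_nonneg ht.le (Real.exp_pos _).le)]
        congr 1
        ring

theorem measurable_card_rivals (q : α → ℝ) (u : α) :
    Measurable fun z => ((rivals q z u).card : ℝ≥0∞) := by
  classical
  have h : (fun z : α → ℝ => ((rivals q z u).card : ℝ≥0∞)) = fun z =>
      ∑ v, {z : α → ℝ | v ≠ u ∧ q u / z u ≤ q v / z v}.indicator 1 z := by
    funext z
    simp [rivals, Set.indicator_apply]
  rw [h]
  refine Finset.measurable_sum _ fun v _ => measurable_one.indicator ?_
  exact (MeasurableSet.const _).inter (measurableSet_div_le_div q u v)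

/-- The expected number of rivals under `q` of the winner `u` under `p` is at most `p u / q u`. -/
theorem lintegral_wins_mul_card_rivals_le {p q : α → ℝ} (hp : ∀ v, 0 ≤ p v) (hp1 : ∑ v, p v = 1)
    (hq : ∀ v, 0 ≤ q v) (hq1 : ∑ v, q v ≤ 1) {u : α} (hu : 0 < q u) :
    ∫⁻ z, {z | Wins p z u}.indicator 1 z * ((rivals q z u).card : ℝ≥0∞) ∂raceMeasure α
      ≤ ENNReal.ofReal (p u) * ENNReal.ofReal (p u / q u) := by
  classical
  rcases (hp u).eq_or_lt with hpu | hpu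
  · rw [← hpu, ENNReal.ofReal_zero, zero_mul, nonpos_iff_eq_zero]
    rw [← lintegral_zero (μ := raceMeasure α)]
    refine lintegral_congr_ae ?_
    have := raceMeasure_wins_eq_zero hp hp1 hpu.symm
    rw [measure_eq_zero_iff_ae_notMem] at this
    filter_upwards [this] with z hz
    rw [Set.indicator_of_notMem hz, zero_mul]
  have h : ∀ z, {z | Wins p z u}.indicator 1 z * ((rivals q z u).card : ℝ≥0∞)
      = ∑ v ∈ univ.erase u,
        ({z | Wins p z u} ∩ {z | q u / z u ≤ q v / z v}).indicator 1 z := by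
    intro z
    by_cases hz : Wins p z u
    · have hr : rivals q z u = (univ.erase u).filter fun v => q u / z u ≤ q v / z v := by
        ext v; simp [rivals]
      rw [hr]
      simp only [Set.indicator_apply, Set.mem_inter_iff, Set.mem_ofPred_eq, hz, true_and, if_true,
        one_mul, Pi.one_apply, sum_boole]
    · simp [hz]
  simp_rw [h]
  have hms : ∀ v, MeasurableSet ({z | Wins p z u} ∩ {z | q u / z u ≤ q v / z v}) := fun v =>
    (measurableSet_wins p u).inter (measurableSet_div_le_div q u v)
  rw [lintegral_finsetSum _ fun v _ => measurable_one.indicator (hms v)]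
  calc ∑ v ∈ univ.erase u, ∫⁻ z,
        ({z | Wins p z u} ∩ {z | q u / z u ≤ q v / z v}).indicator 1 z ∂raceMeasure α
      ≤ ∑ v ∈ univ.erase u, ENNReal.ofReal (p u ^ 2) * ENNReal.ofReal (q v / q u) := by
        refine sum_le_sum fun v hv => ?_
        rw [lintegral_indicator_one (hms v)]
        exact raceMeasure_wins_inter_le hp hp1 (ne_of_mem_erase hv) hpu hu (hq v)
    _ ≤ ENNReal.ofReal (p u ^ 2) * ENNReal.ofReal (1 / q u) := by
        rw [← mul_sum, ← ENNReal.ofReal_sum_of_nonneg fun v _ => div_nonneg (hq v) hu.le,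
          ← sum_div]
        gcongr
        exact (sum_le_sum_of_subset_of_nonneg (erase_subset _ _) fun v _ _ => hq v).trans hq1
    _ = _ := by
        rw [← ENNReal.ofReal_mul (by positivity), ← ENNReal.ofReal_mul hpu.le]
        congr 1
        ring

/-- Inverse ranks sum to at most `ln |α| + 1`. -/
theorem sum_inv_card_rivals_le (q z : α → ℝ) :
    ∑ u, (((rivals q z u).card : ℝ) + 1)⁻¹ ≤ Real.log (Fintype.card α) + 1 := by
  have h := sum_inv_card_rivals_le_harmonic (fun u => q u / z u) univ
  have h2 := harmonic_le_one_add_log (univ : Finset α).card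
  rw [add_comm]
  exact h.trans h2

end Race

end ADN

/-! ### Finite chains of kernels and of sub-probability weights -/

namespace ADN

open Finset
open scoped ENNReal

theorem sum_pmf {α : Type*} [Fintype α] (p : PMF α) : ∑ a, p a = 1 := by
  rw [← tsum_fintype (L := .unconditional _)]; exact p.tsum_coe

theorem sum_pmf_toReal {α : Type*} [Fintype α] (p : PMF α) : ∑ a, (p a).toReal = 1 := by
  rw [← ENNReal.toReal_sum fun a _ => p.apply_ne_top a, sum_pmf, ENNReal.toReal_one]

open Classical in
theorem map_apply_fintype {Ω α : Type*} [Fintype Ω] (p : PMF Ω) (V : Ω → α) (a : α) :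
    (p.map V) a = ∑ ω, if V ω = a then p ω else 0 := by
  rw [PMF.map_apply, tsum_fintype]
  exact sum_congr rfl fun ω _ => by simp only [eq_comm]

theorem le_map_apply {Ω α : Type*} [Fintype Ω] (p : PMF Ω) (V : Ω → α) (ω : Ω) :
    p ω ≤ (p.map V) (V ω) := by
  classical
  rw [map_apply_fintype]
  refine le_trans ?_ (single_le_sum (f := fun ω' => if V ω' = V ω then p ω' else 0)
    (fun _ _ => zero_le) (mem_univ ω))
  simp

theorem bind_bind_map_apply {α β γ : Type*} (p : PMF β) (q : β → PMF γ) (r : β → γ → PMF α)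
    (a : α) (b : β) (c : γ) :
    (p.bind fun b => (q b).bind fun c => (r b c).map fun a => (a, b, c)) (a, b, c)
      = p b * q b c * r b c a := by
  classical
  have h : ∀ b' c', ((r b' c').map fun a => (a, b', c')) (a, b, c)
      = if b' = b ∧ c' = c then r b c a else 0 := by
    intro b' c'
    rw [PMF.map_apply]
    by_cases hbc : b' = b ∧ c' = c
    · obtain ⟨rfl, rfl⟩ := hbc
      rw [tsum_eq_single a fun a' ha' => by simp [ha'.symm]]
      simp
    · rw [if_neg hbc]
      refine ENNReal.tsum_eq_zero.2 fun a' => if_neg ?_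
      simp only [Prod.mk.injEq, not_and]
      exact fun _ h1 h2 => hbc ⟨h1.symm, h2.symm⟩
  simp only [PMF.bind_apply, h]
  rw [tsum_eq_single b fun b' hb' => by simp [hb'], tsum_eq_single c fun c' hc' => by simp [hc']]
  simp [mul_assoc]

section Chain

variable {N : ℕ} {Z : Fin N → Type*} [∀ i, Fintype (Z i)]

open Classical in
/-- The probability under a chain that an initial set of coordinates takes given values. -/
theorem sum_chainLaw_initial (κ : ∀ i, (∀ j, j < i → Z j) → PMF (Z i)) (S : Finset (Fin N))
    (hS : ∀ l ∈ S, ∀ j, j < l → j ∈ S) (r : ∀ i, Z i) :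
    ∑ z, chainLaw κ z * (if ∀ l ∈ S, z l = r l then 1 else 0)
      = ∏ l ∈ S, κ l (fun j _ => r j) (r l) := by
  -- Replacing the kernels on `S` by point masses gives another chain, whose total mass is one.
  -- Since `S` is closed under predecessors, the replaced factors are constants on the event.
  let κ' : ∀ i, (∀ j, j < i → Z j) → PMF (Z i) := fun i p =>
    if i ∈ S then PMF.pure (r i) else κ i p
  have h : ∀ z, chainLaw κ z * (if ∀ l ∈ S, z l = r l then 1 else 0)
      = (∏ l ∈ S, κ l (fun j _ => r j) (r l)) * chainLaw κ' z := by
    intro z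
    change (∏ i, κ i (fun j _ => z j) (z i)) * _ = _ * ∏ i, κ' i (fun j _ => z j) (z i)
    split_ifs with hz
    · rw [mul_one, ← prod_mul_prod_compl S, ← prod_mul_prod_compl S fun i => κ' i _ (z i)]
      have h1 : ∏ i ∈ S, κ' i (fun j _ => z j) (z i) = 1 :=
        prod_eq_one fun i hi => by simp [κ', hi, hz i hi]
      have h2 : ∏ i ∈ Sᶜ, κ' i (fun j _ => z j) (z i) = ∏ i ∈ Sᶜ, κ i (fun j _ => z j) (z i) :=
        prod_congr rfl fun i hi => by simp [κ', mem_compl.1 hi]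
      rw [h1, h2, one_mul]
      congr 1
      refine prod_congr rfl fun i hi => ?_
      have : (fun j (_ : j < i) => z j) = fun j _ => r j := by
        funext j hj; exact hz j (hS i hi j hj)
      rw [this, hz i hi]
    · rw [mul_zero]
      push Not at hz
      obtain ⟨l, hl, hzl⟩ := hz
      rw [prod_eq_zero (mem_univ l) (by simp [κ', hl, hzl]), mul_zero]
  simp_rw [h]
  rw [← mul_sum, sum_pmf, mul_one]

/-- Under a chain, the conditional law of `Z_i` given the past is the `i`-th kernel. -/
theorem sum_chainLaw_step (κ : ∀ i, (∀ j, j < i → Z j) → PMF (Z i)) (i : Fin N)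
    (G : (∀ j, j < i → Z j) → Z i → ℝ≥0∞) :
    ∑ z, chainLaw κ z * G (fun j _ => z j) (z i)
      = ∑ z, chainLaw κ z * ∑ c, κ i (fun j _ => z j) c * G (fun j _ => z j) c := by
  classical
  obtain ⟨z₀, -⟩ := (chainLaw κ).support_nonempty
  let ρ : (∀ i, Z i) → ∀ l : {l // l < i}, Z l := fun z l => z l
  have key : ∀ (q : ∀ l : {l // l < i}, Z l) (c : Z i),
      ∑ z, chainLaw κ z * (if ρ z = q then (if z i = c then 1 else 0) else 0)
        = κ i (fun j h => q ⟨j, h⟩) c * ∑ z, chainLaw κ z * (if ρ z = q then 1 else 0) := by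
    intro q c
    -- Extends the past `q` and the value `c` to a full sequence; `z₀` only fills coordinates after
    -- `i`. Comparing the initial segments `Iio i` and `Iic i` isolates the kernel at `i`.
    let r : ∀ l, Z l := Function.update (fun l => if h : l < i then q ⟨l, h⟩ else z₀ l) i c
    have hr : ∀ l (h : l < i), r l = q ⟨l, h⟩ := fun l h => by simp [r, h.ne, h]
    have hri : r i = c := by simp [r]
    have hρ : ∀ z, (ρ z = q) ↔ ∀ l ∈ Iio i, z l = r l := fun z => by
      constructor
      · rintro rfl l hl
        rw [hr l (mem_Iio.1 hl)]
      · intro h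
        funext l
        exact (h l (mem_Iio.2 l.2)).trans (hr l l.2)
    have h1 := sum_chainLaw_initial κ (Iio i)
      (fun l hl j hj => mem_Iio.2 (hj.trans (mem_Iio.1 hl))) r
    have h2 := sum_chainLaw_initial κ (Iic i)
      (fun l hl j hj => mem_Iic.2 (hj.le.trans (mem_Iic.1 hl))) r
    have h3 : (Iic i) = insert i (Iio i) := (Iio_insert i).symm
    rw [h3, prod_insert (by simp), ← h1] at h2
    have h4 : (fun j (_ : j < i) => r j) = fun j h => q ⟨j, h⟩ := by funext j h; exact hr j h
    rw [h4, hri] at h2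
    simp_rw [hρ, ← h2]
    refine sum_congr rfl fun z _ => ?_
    congr 1
    rw [← ite_and]
    simp only [forall_mem_insert, hri, and_comm]
  have hG : ∀ z, G (fun j _ => z j) (z i) = ∑ q : ∀ l : {l // l < i}, Z l, ∑ c,
      (if ρ z = q then (if z i = c then 1 else 0) else 0) * G (fun j h => q ⟨j, h⟩) c := by
    intro z
    simp [ρ]
  have hG' : ∀ z, ∑ c, κ i (fun j _ => z j) c * G (fun j _ => z j) c
      = ∑ q : ∀ l : {l // l < i}, Z l, ∑ c, (if ρ z = q then 1 else 0)
        * (κ i (fun j h => q ⟨j, h⟩) c * G (fun j h => q ⟨j, h⟩) c) := by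
    intro z
    rw [sum_comm]
    simp only [ite_mul, one_mul, zero_mul, sum_ite_eq, mem_univ, if_true]
    rfl
  calc _ = ∑ q : ∀ l : {l // l < i}, Z l, ∑ c,
        (∑ z, chainLaw κ z * (if ρ z = q then (if z i = c then 1 else 0) else 0))
          * G (fun j h => q ⟨j, h⟩) c := by
        simp_rw [hG, mul_sum, sum_mul, ← mul_assoc]
        rw [sum_comm]
        exact sum_congr rfl fun q _ => sum_comm
    _ = ∑ q : ∀ l : {l // l < i}, Z l, ∑ c,
        (∑ z, chainLaw κ z * (if ρ z = q then 1 else 0))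
          * (κ i (fun j h => q ⟨j, h⟩) c * G (fun j h => q ⟨j, h⟩) c) := by
        refine sum_congr rfl fun q _ => sum_congr rfl fun c _ => ?_
        rw [key]; ring
    _ = _ := by
        simp_rw [hG', mul_sum, sum_mul, ← mul_assoc]
        rw [sum_comm]
        refine (sum_congr rfl fun q _ => sum_comm).symm.trans ?_
        rw [sum_comm]
        exact sum_congr rfl fun z _ => sum_comm

end Chain

/-- A product of successive sub-probability weights, each depending on the later coordinates, sums
to at most one. -/
theorem sum_prod_revChain_le : ∀ {d : ℕ} {T : Fin d → Type*} [∀ i, Fintype (T i)]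
    (φ : ∀ k, (∀ l, k < l → T l) → T k → ℝ) (_ : ∀ k p v, 0 ≤ φ k p v)
    (_ : ∀ k p, ∑ v, φ k p v ≤ 1),
    ∑ s : (∀ k, T k), ∏ k, φ k (fun l _ => s l) (s k) ≤ 1 := by
  intro d
  induction d with
  | zero => intro T _ φ _ _; simp
  | succ n ih =>
    intro T _ φ h0 h1
    -- No other factor involves coordinate `0`, so it can be summed out first; `φ'` is the chain
    -- that remains.
    let φ' : ∀ k : Fin n, (∀ l, k < l → T l.succ) → T k.succ → ℝ := fun k p v =>
      φ k.succ (Fin.cases (motive := fun l => k.succ < l → T l)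
        (fun h => absurd h (Fin.not_lt_zero _)) fun l h => p l (Fin.succ_lt_succ_iff.1 h)) v
    have ih' := ih φ' (fun _ _ _ => h0 _ _ _) fun _ _ => h1 _ _
    rw [← (Fin.consEquiv T).sum_comp, Fintype.sum_prod_type_right]
    refine le_trans (sum_le_sum fun s _ => ?_) ih'
    have key : ∀ v : T 0, ∏ k, φ k (fun l _ => (Fin.consEquiv T) (v, s) l) ((Fin.consEquiv T) (v, s) k)
        = φ 0 (fun l hl => (Fin.consEquiv T) (v, s) l) v
          * ∏ k, φ' k (fun l _ => s l) (s k) := by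
      intro v
      rw [Fin.prod_univ_succ]
      congr 1
      refine prod_congr rfl fun k _ => ?_
      change φ k.succ _ (s k) = φ k.succ _ (s k)
      congr 1
      funext l hl
      cases l using Fin.cases with
      | zero => exact absurd hl (Fin.not_lt_zero _)
      | succ l => rfl
    simp_rw [key]
    rw [← sum_mul]
    refine mul_le_of_le_one_left (prod_nonneg fun _ _ => h0 _ _ _) ?_
    rcases isEmpty_or_nonempty (T 0) with hT | ⟨⟨v₀⟩⟩
    · simp
    refine le_trans (le_of_eq (sum_congr rfl fun v _ => ?_))
      (h1 0 fun l _ => (Fin.consEquiv T) (v₀, s) l)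
    congr 1
    funext l hl
    cases l using Fin.cases with
    | zero => exact absurd hl (lt_irrefl _)
    | succ l => rfl

end ADN

/-! ### Conditional probabilities and the ideal law -/

namespace ADN

open Finset
open scoped ENNReal

section CondProb

variable {Ω α β : Type*}

/-- The conditional probability `P_{V|W}(v|w)`, zero if `w` has probability zero. -/
noncomputable def condProb (p : PMF Ω) (V : Ω → α) (W : Ω → β) (v : α) (w : β) : ℝ :=
  ((p.map fun ω => (V ω, W ω)) (v, w)).toReal / ((p.map W) w).toReal

theorem condProb_nonneg (p : PMF Ω) (V : Ω → α) (W : Ω → β) (v : α) (w : β) :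
    0 ≤ condProb p V W v w :=
  div_nonneg ENNReal.toReal_nonneg ENNReal.toReal_nonneg

variable [Fintype Ω]

theorem map_apply_toReal_pos (p : PMF Ω) (V : Ω → α) {ω : Ω} (hω : p ω ≠ 0) :
    0 < ((p.map V) (V ω)).toReal :=
  ENNReal.toReal_pos ((pos_iff_ne_zero.2 hω).trans_le (le_map_apply p V ω)).ne'
    (PMF.apply_ne_top _ _)

theorem condProb_pos (p : PMF Ω) (V : Ω → α) (W : Ω → β) {ω : Ω} (hω : p ω ≠ 0) :
    0 < condProb p V W (V ω) (W ω) :=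
  div_pos (map_apply_toReal_pos p (fun ω => (V ω, W ω)) hω) (map_apply_toReal_pos p W hω)

theorem sum_condProb_le_one [Fintype α] (p : PMF Ω) (V : Ω → α) (W : Ω → β) (w : β) :
    ∑ v, condProb p V W v w ≤ 1 := by
  classical
  have h : ∑ v, (p.map fun ω => (V ω, W ω)) (v, w) = (p.map W) w := by
    simp_rw [map_apply_fintype]
    rw [sum_comm]
    refine sum_congr rfl fun ω _ => ?_
    by_cases hw : W ω = w <;> simp [hw, Prod.ext_iff]
  simp only [condProb]
  rw [← sum_div, ← ENNReal.toReal_sum fun v _ => PMF.apply_ne_top _ _, h]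
  exact div_self_le_one _

/-- The marginal of `V` cancels. Positive mass of `ω` makes all the probabilities positive, so that
the logarithms can be inverted. -/
theorem two_rpow_infoDensity {γ : Type*} (p : PMF Ω) (V : Ω → α) (W : Ω → β) (W' : Ω → γ) {ω : Ω}
    (hω : p ω ≠ 0) :
    (2 : ℝ) ^ (-infoDensity p V W ω + infoDensity p V W' ω)
      = condProb p V W' (V ω) (W' ω) / condProb p V W (V ω) (W ω) := by
  have hV := map_apply_toReal_pos p V hω
  have h1 := condProb_pos p V W hω
  have h2 := condProb_pos p V W' hω
  have e1 : infoDensity p V W ω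
      = Real.logb 2 (condProb p V W (V ω) (W ω) / ((p.map V) (V ω)).toReal) := rfl
  have e2 : infoDensity p V W' ω
      = Real.logb 2 (condProb p V W' (V ω) (W' ω) / ((p.map V) (V ω)).toReal) := rfl
  rw [Real.rpow_add two_pos, Real.rpow_neg two_pos.le, e1, e2,
    Real.rpow_logb two_pos (by norm_num) (div_pos h1 hV),
    Real.rpow_logb two_pos (by norm_num) (div_pos h2 hV)]
  field_simp

end CondProb

section IdealLaw

variable {N : ℕ} {X Y U : Fin N → Type*}

/-- The value of `Ū'_i` in a past. -/
def pastUBar (D : DecodingOrder N) (i : Fin N) (past : ∀ j, j < i → X j × Y j × U j) :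
    D.UBar U i (D.unique i) :=
  fun j => (past (D.a i j) (D.a_lt i j)).2.2

/-- The conditional law of `(X_i, Y_i, U_i)` given the past, under the ideal law. -/
noncomputable def idealKernel (P : Network X Y) (D : DecodingOrder N) (A : Auxiliary X Y U D)
    (i : Fin N) (past : ∀ j, j < i → X j × Y j × U j) : PMF (X i × Y i × U i) :=
  (P i (fun j hj => (past j hj).1) (fun j hj => (past j hj).2.1)).bind fun y =>
    (A.pU i y (pastUBar D i past)).bind fun u =>
      (A.pX i y u (pastUBar D i past)).map fun x => (x, y, u)

theorem idealKernel_apply (P : Network X Y) (D : DecodingOrder N) (A : Auxiliary X Y U D)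
    (i : Fin N) (past : ∀ j, j < i → X j × Y j × U j) (c : X i × Y i × U i) :
    idealKernel P D A i past c
      = P i (fun j hj => (past j hj).1) (fun j hj => (past j hj).2.1) c.2.1
        * A.pU i c.2.1 (pastUBar D i past) c.2.2
        * A.pX i c.2.1 c.2.2 (pastUBar D i past) c.1 :=
  bind_bind_map_apply _ _ _ _ _ _

variable [∀ i, Fintype (X i)] [∀ i, Fintype (Y i)] [∀ i, Fintype (U i)]

theorem idealLaw_apply (P : Network X Y) (D : DecodingOrder N) (A : Auxiliary X Y U D)
    (ω : Outcome X Y U) :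
    idealLaw P D A ω = ∏ i, (P i (fun j _ => Outcome.x ω j) (fun j _ => Outcome.y ω j) (Outcome.y ω i)
        * A.pU i (Outcome.y ω i) (Outcome.uBar ω D i (D.unique i)) (Outcome.u ω i)
        * A.pX i (Outcome.y ω i) (Outcome.u ω i) (Outcome.uBar ω D i (D.unique i))
          (Outcome.x ω i)) := by
  change ∏ i, idealKernel P D A i (fun j _ => ω j) (ω i) = _
  exact prod_congr rfl fun i _ => idealKernel_apply P D A i (fun j _ => ω j) (ω i)

/-- Under the ideal law, the conditional law of `U_i` given `(Ū'_i, Y_i)` is `P_{U_i|Y_i,Ū'_i}`. -/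
theorem map_idealLaw_u (P : Network X Y) (D : DecodingOrder N) (A : Auxiliary X Y U D)
    (i : Fin N) (u : U i) (b : D.UBar U i (D.unique i)) (y : Y i) :
    ((idealLaw P D A).map fun ω =>
        (Outcome.u ω i, (Outcome.uBar ω D i (D.unique i), Outcome.y ω i))) (u, (b, y))
      = ((idealLaw P D A).map fun ω => (Outcome.uBar ω D i (D.unique i), Outcome.y ω i)) (b, y)
        * A.pU i y b u := by
  classical
  -- The one-step identity is applied to the indicators with and without the condition on `U_i`;
  -- summing out `X_i` leaves sums differing by exactly the factor `A.pU i y b u`.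
  have h1 := sum_chainLaw_step (idealKernel P D A) i fun past c =>
    if pastUBar D i past = b then (if c.2.1 = y then (if c.2.2 = u then 1 else 0) else 0) else 0
  have h2 := sum_chainLaw_step (idealKernel P D A) i fun past c =>
    if pastUBar D i past = b then (if c.2.1 = y then 1 else 0) else 0
  have e1 : ∀ ω : Outcome X Y U, ∑ c, idealKernel P D A i (fun j _ => ω j) c
      * (if pastUBar D i (fun j _ => ω j) = b then
          (if c.2.1 = y then (if c.2.2 = u then 1 else 0) else 0) else 0)
      = (if pastUBar D i (fun j _ => ω j) = b then
          P i (fun j _ => (ω j).1) (fun j _ => (ω j).2.1) y else 0) * A.pU i y b u := by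
    intro ω
    simp only [idealKernel_apply]
    split_ifs with hb
    · rw [Fintype.sum_prod_type]
      simp only [Fintype.sum_prod_type, mul_ite, mul_one, mul_zero, sum_ite_eq', mem_univ, if_true,
        sum_const_zero, hb, Finset.sum_ite_irrel]
      rw [← mul_sum, sum_pmf, mul_one]
    · simp
  have e2 : ∀ ω : Outcome X Y U, ∑ c, idealKernel P D A i (fun j _ => ω j) c
      * (if pastUBar D i (fun j _ => ω j) = b then (if c.2.1 = y then 1 else 0) else 0)
      = (if pastUBar D i (fun j _ => ω j) = b then
          P i (fun j _ => (ω j).1) (fun j _ => (ω j).2.1) y else 0) := by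
    intro ω
    simp only [idealKernel_apply]
    split_ifs with hb
    · rw [Fintype.sum_prod_type_right]
      simp only [Fintype.sum_prod_type, mul_ite, mul_one, mul_zero,
        hb, Finset.sum_ite_irrel, ← mul_sum, sum_pmf, sum_ite_eq', mem_univ, if_true, sum_const_zero]
    · simp
  simp_rw [e1, ← mul_assoc, ← sum_mul] at h1
  simp_rw [e2] at h2
  rw [← h2] at h1
  rw [map_apply_fintype, map_apply_fintype]
  refine Eq.trans (sum_congr rfl fun ω _ => ?_) (h1.trans ?_)
  · change _ = idealLaw P D A ω * (if Outcome.uBar ω D i (D.unique i) = b then _ else 0)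
    by_cases h3 : Outcome.uBar ω D i (D.unique i) = b <;> by_cases h4 : (ω i).2.1 = y <;>
      by_cases h5 : (ω i).2.2 = u <;> simp [h3, h4, h5]
  · congr 1
    refine sum_congr rfl fun ω _ => ?_
    change idealLaw P D A ω * (if Outcome.uBar ω D i (D.unique i) = b then _ else 0) = _
    by_cases h3 : Outcome.uBar ω D i (D.unique i) = b <;> by_cases h4 : (ω i).2.1 = y <;>
      simp [h3, h4]

theorem condProb_idealLaw_u (P : Network X Y) (D : DecodingOrder N) (A : Auxiliary X Y U D)
    (i : Fin N) {ω : Outcome X Y U} (hω : idealLaw P D A ω ≠ 0) :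
    condProb (idealLaw P D A) (fun ω => Outcome.u ω i)
        (fun ω => (Outcome.uBar ω D i (D.unique i), Outcome.y ω i)) (Outcome.u ω i)
        (Outcome.uBar ω D i (D.unique i), Outcome.y ω i)
      = (A.pU i (Outcome.y ω i) (Outcome.uBar ω D i (D.unique i)) (Outcome.u ω i)).toReal := by
  have h := map_apply_toReal_pos (idealLaw P D A)
    (fun ω => (Outcome.uBar ω D i (D.unique i), Outcome.y ω i)) hω
  rw [condProb, map_idealLaw_u, ENNReal.toReal_mul]
  field_simp

end IdealLaw

end ADN

/-! ### The successive decoder and its weights -/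

namespace ADN

open Finset
open scoped ENNReal

/-- A winner of the race with weights `q` and marks `z`. -/
noncomputable def winner {α : Type*} [Finite α] [Nonempty α] (q z : α → ℝ) : α :=
  (exists_wins q z).choose

theorem winner_wins {α : Type*} [Finite α] [Nonempty α] (q z : α → ℝ) : Wins q z (winner q z) :=
  (exists_wins q z).choose_spec

theorem Wins.eq_of_rivals_eq_empty {α : Type*} [Fintype α] {q z : α → ℝ} {u v : α}
    (hv : Wins q z v) (h : rivals q z u = ∅) : v = u := by
  by_contra hne
  have : v ∈ rivals q z u := by simpa [rivals, hne] using hv u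
  simp [h] at this

section Decoder

variable {N : ℕ} {X Y U : Fin N → Type*}

/-- The marks at the nodes: those at node `l` select `U_l` and `X_l`. -/
abbrev Marks (X U : Fin N → Type*) : Type _ := ∀ l, (U l → ℝ) × (X l → ℝ)

/-- The value of `Ū_{i,[d_i] ∖ {j,…,k}}` made from the coordinates before `j` and after `k`. -/
def mixedUBar (D : DecodingOrder N) (i : Fin N) (j k : Fin (D.d i))
    (past : ∀ l, l < j → U (D.a i l)) (fut : ∀ l, k < l → U (D.a i l)) :
    D.UBar U i (Icc j k)ᶜ :=
  fun l => if h : (l : Fin (D.d i)) < j then past l h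
    else fut l (not_le.1 fun h' => mem_compl.1 l.2 (mem_Icc.2 ⟨not_lt.1 h, h'⟩))

theorem mixedUBar_uBar (D : DecodingOrder N) (i : Fin N) (j k : Fin (D.d i))
    (ω : Outcome X Y U) :
    mixedUBar D i j k (fun l _ => Outcome.u ω (D.a i l)) (fun l _ => Outcome.u ω (D.a i l))
      = Outcome.uBar ω D i (Icc j k)ᶜ := by
  funext l
  simp [mixedUBar, Outcome.uBar]

variable [∀ i, Fintype (U i)] (p : PMF (Outcome X Y U)) (D : DecodingOrder N)
  (z : Marks X U) (i : Fin N)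

/-- The conditional law of `Ū_{i,k}` given `Ū_{i,[d_i] ∖ {j,…,k}}` and `Y_i`. -/
noncomputable def layerProb (j : Fin (D.d i)) (y : Y i) (past : ∀ l, l < j → U (D.a i l))
    (k : Fin (D.d i)) (fut : ∀ l, k < l → U (D.a i l)) (v : U (D.a i k)) : ℝ :=
  condProb p (fun ω => Outcome.u ω (D.a i k))
    (fun ω => (Outcome.uBar ω D i (Icc j k)ᶜ, Outcome.y ω i)) v (mixedUBar D i j k past fut, y)

open Classical in
/-- The factor of the coordinate `k` in the law of `Ū_i` refined by the marks, as used when the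
coordinate `j` is decoded. -/
noncomputable def layerWeight (j : Fin (D.d i)) (y : Y i) (past : ∀ l, l < j → U (D.a i l))
    (k : Fin (D.d i)) (fut : ∀ l, k < l → U (D.a i l)) (v : U (D.a i k)) : ℝ :=
  if h : k < j then (if v = past k h then 1 else 0)
  else if j < k then
    (((rivals (layerProb p D i j y past k fut) (z (D.a i k)).1 v).card : ℝ) + 1)⁻¹
      * (Real.log (Fintype.card (U (D.a i k))) + 1)⁻¹
  else layerProb p D i j y past k fut v

open Classical in
/-- The weights with which the coordinate `j` is decoded at the node `i`. -/
noncomputable def decodeWeight (j : Fin (D.d i)) (y : Y i) (past : ∀ l, l < j → U (D.a i l))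
    (v : U (D.a i j)) : ℝ :=
  ∑ s : (∀ k, U (D.a i k)),
    if s j = v then ∏ k, layerWeight p D z i j y past k (fun l _ => s l) (s k) else 0

theorem logCard_add_one_pos (α : Type*) [Fintype α] : 0 < Real.log (Fintype.card α) + 1 := by
  have := Real.log_natCast_nonneg (Fintype.card α)
  positivity

theorem layerWeight_nonneg [∀ i, Fintype (X i)] [∀ i, Fintype (Y i)] (j : Fin (D.d i)) (y : Y i)
    (past : ∀ l, l < j → U (D.a i l))
    (k : Fin (D.d i)) (fut : ∀ l, k < l → U (D.a i l)) (v : U (D.a i k)) :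
    0 ≤ layerWeight p D z i j y past k fut v := by
  unfold layerWeight
  split_ifs
  · exact zero_le_one
  · exact le_rfl
  · have := logCard_add_one_pos (U (D.a i k))
    positivity
  · exact condProb_nonneg _ _ _ _ _

/-- Before `j` the weight is a point mass, at `j` a conditional law, and after `j` normalized
inverse ranks, whose sum is controlled by the harmonic bound. -/
theorem sum_layerWeight_le_one [∀ i, Fintype (X i)] [∀ i, Fintype (Y i)] (j : Fin (D.d i)) (y : Y i)
    (past : ∀ l, l < j → U (D.a i l))
    (k : Fin (D.d i)) (fut : ∀ l, k < l → U (D.a i l)) :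
    ∑ v, layerWeight p D z i j y past k fut v ≤ 1 := by
  classical
  unfold layerWeight
  split_ifs
  · simp
  · rw [← sum_mul, ← div_eq_mul_inv, div_le_one (logCard_add_one_pos _)]
    exact sum_inv_card_rivals_le _ _
  · exact sum_condProb_le_one _ _ _ _

theorem prod_layerWeight_le_decodeWeight [∀ i, Fintype (X i)] [∀ i, Fintype (Y i)]
    (j : Fin (D.d i)) (y : Y i)
    (past : ∀ l, l < j → U (D.a i l)) (s : ∀ k, U (D.a i k)) :
    ∏ k, layerWeight p D z i j y past k (fun l _ => s l) (s k)
      ≤ decodeWeight p D z i j y past (s j) := by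
  classical
  refine le_trans ?_ (single_le_sum (f := fun s' : (∀ k, U (D.a i k)) =>
    if s' j = s j then ∏ k, layerWeight p D z i j y past k (fun l _ => s' l) (s' k) else 0)
    (fun s' _ => ?_) (mem_univ s))
  · simp
  · split_ifs
    · exact prod_nonneg fun _ _ => layerWeight_nonneg _ _ _ _ _ _ _ _ _ _
    · exact le_rfl

theorem decodeWeight_nonneg [∀ i, Fintype (X i)] [∀ i, Fintype (Y i)]
    (j : Fin (D.d i)) (y : Y i) (past : ∀ l, l < j → U (D.a i l)) (v : U (D.a i j)) :
    0 ≤ decodeWeight p D z i j y past v := by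
  refine sum_nonneg fun s _ => ?_
  split_ifs
  · exact prod_nonneg fun _ _ => layerWeight_nonneg _ _ _ _ _ _ _ _ _ _
  · exact le_rfl

theorem sum_decodeWeight_le_one [∀ i, Fintype (X i)] [∀ i, Fintype (Y i)]
    (j : Fin (D.d i)) (y : Y i) (past : ∀ l, l < j → U (D.a i l)) :
    ∑ v, decodeWeight p D z i j y past v ≤ 1 := by
  classical
  unfold decodeWeight
  rw [sum_comm]
  simp only [sum_ite_eq, mem_univ, if_true]
  exact sum_prod_revChain_le _ (fun _ _ _ => layerWeight_nonneg _ _ _ _ _ _ _ _ _ _)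
    fun _ _ => sum_layerWeight_le_one _ _ _ _ _ _ _ _ _

variable [∀ i, Nonempty (U i)]

/-- The auxiliaries decoded successively at the node `i`. -/
noncomputable def decoded (y : Y i) : ∀ j, U (D.a i j) :=
  (wellFounded_lt (α := Fin (D.d i))).fix fun j past =>
    winner (decodeWeight p D z i j y past) (z (D.a i j)).1

theorem decoded_eq (y : Y i) (j : Fin (D.d i)) :
    decoded p D z i y j = winner (decodeWeight p D z i j y fun l _ => decoded p D z i y l)
      (z (D.a i j)).1 :=
  WellFounded.fix_eq _ _ j

/-- The outcome `ω` has a rival of the true auxiliary at some decoding step. -/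
def DecodingError (ω : Outcome X Y U) : Prop :=
  ∃ i, ∃ j ∈ D.unique i, (rivals (decodeWeight p D z i j (Outcome.y ω i)
    fun l _ => Outcome.u ω (D.a i l)) (z (D.a i j)).1 (Outcome.u ω (D.a i j))).Nonempty

/-- The uniquely decoded coordinates form an initial segment, so by induction the decoder's past at
`j` is the true one. Its weights are then those in the error event, and the absence of rivals leaves
only one possible winner. -/
theorem decoded_eq_of_not_decodingError {ω : Outcome X Y U} (h : ¬DecodingError p D z ω)
    (j : Fin (D.d i)) (hj : j ∈ D.unique i) :
    decoded p D z i (Outcome.y ω i) j = Outcome.u ω (D.a i j) := by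
  induction j using WellFoundedLT.induction with
  | ind j ih =>
    have hpast : (fun l (_ : l < j) => decoded p D z i (Outcome.y ω i) l)
        = fun l _ => Outcome.u ω (D.a i l) := by
      funext l hl
      refine ih l hl ?_
      simp only [DecodingOrder.unique, mem_filter, mem_univ, true_and] at hj ⊢
      exact (Fin.lt_def.1 hl).trans hj
    rw [decoded_eq, hpast]
    refine (winner_wins _ _).eq_of_rivals_eq_empty ?_
    by_contra hne
    exact h ⟨i, j, hj, nonempty_iff_ne_empty.2 hne⟩

end Decoder

theorem map_apply_of_leftInverse {α β : Type*} (p : PMF β) (h : β → α) (π : α → β)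
    (hπ : Function.LeftInverse π h) (a : α) [Decidable (h (π a) = a)] :
    (p.map h) a = if h (π a) = a then p (π a) else 0 := by
  classical
  rw [PMF.map_apply]
  split_ifs with ha
  · rw [tsum_eq_single (π a) fun b hb => if_neg fun hab => hb (by rw [hab, hπ]), if_pos ha.symm]
  · exact ENNReal.tsum_eq_zero.2 fun b => if_neg fun hab => ha (by rw [hab, hπ])

theorem prod_ite_forall {ι : Type*} [Fintype ι] (c : ι → Prop) [∀ i, Decidable (c i)]
    [Decidable (∀ i, c i)] (g : ι → ℝ≥0∞) :
    ∏ i, (if c i then g i else 0) = if ∀ i, c i then ∏ i, g i else 0 := by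
  split_ifs with h
  · exact prod_congr rfl fun i _ => if_pos (h i)
  · push Not at h
    obtain ⟨i, hi⟩ := h
    exact prod_eq_zero (mem_univ i) (if_neg hi)

open Classical in
theorem schemeLaw_apply {N : ℕ} {X Y : Fin N → Type*} [∀ i, Fintype (X i)]
    [∀ i, Fintype (Y i)] (P : Network X Y) (f : DeterministicScheme X Y) (s : ∀ i, X i × Y i) :
    schemeLaw P f s = if ∀ i, f i (s i).2 = (s i).1 then
      ∏ i, P i (fun j _ => (s j).1) (fun j _ => (s j).2) (s i).2 else 0 := by
  rw [← prod_ite_forall]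
  change ∏ i, ((P i (fun j _ => (s j).1) fun j _ => (s j).2).map fun y => (f i y, y)) (s i) = _
  refine prod_congr rfl fun i _ => ?_
  rw [map_apply_of_leftInverse _ _ Prod.snd fun _ => rfl]
  simp [Prod.ext_iff]

/-! ### Coupling the deterministic scheme with the selected outcomes -/

section Coupling

variable {N : ℕ} {X Y U : Fin N → Type*} [∀ i, Fintype (X i)] [∀ i, Fintype (U i)]
  [∀ i, Nonempty (X i)] [∀ i, Nonempty (U i)]

/-- The winner of the race for `U_i`. -/
noncomputable def selectU {D : DecodingOrder N} (A : Auxiliary X Y U D) (z : Marks X U) (i : Fin N)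
    (y : Y i) (b : D.UBar U i (D.unique i)) : U i :=
  winner (fun v => (A.pU i y b v).toReal) (z i).1

/-- The winner of the race for `X_i`. -/
noncomputable def selectX {D : DecodingOrder N} (A : Auxiliary X Y U D) (z : Marks X U) (i : Fin N)
    (y : Y i) (b : D.UBar U i (D.unique i)) : X i :=
  winner (fun v => (A.pX i y (selectU A z i y b) b v).toReal) (z i).2

/-- The deterministic scheme obtained by fixing the marks. -/
noncomputable def markedScheme {D : DecodingOrder N} (p : PMF (Outcome X Y U))
    (A : Auxiliary X Y U D) (z : Marks X U) : DeterministicScheme X Y :=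
  fun i y => selectX A z i y fun j => decoded p D z i y j

/-- The auxiliaries and inputs of `ω` are selected by the marks. -/
def Selected {D : DecodingOrder N} (A : Auxiliary X Y U D) (z : Marks X U)
    (ω : Outcome X Y U) : Prop :=
  ∀ i, selectU A z i (Outcome.y ω i) (Outcome.uBar ω D i (D.unique i)) = Outcome.u ω i ∧
    selectX A z i (Outcome.y ω i) (Outcome.uBar ω D i (D.unique i)) = Outcome.x ω i

theorem Selected.eq_of_not_decodingError {D : DecodingOrder N} {p : PMF (Outcome X Y U)}
    {A : Auxiliary X Y U D} {z : Marks X U} {ω : Outcome X Y U} (hs : Selected A z ω)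
    (h : ¬DecodingError p D z ω) (i : Fin N) :
    markedScheme p A z i (Outcome.y ω i) = Outcome.x ω i ∧
      selectU A z i (Outcome.y ω i) (fun j => decoded p D z i (Outcome.y ω i) j)
        = Outcome.u ω i := by
  have hb : (fun j : D.unique i => decoded p D z i (Outcome.y ω i) j)
      = Outcome.uBar ω D i (D.unique i) :=
    funext fun j => decoded_eq_of_not_decodingError p D z i h j j.2
  rw [markedScheme, hb]
  exact ⟨(hs i).2, (hs i).1⟩

variable [∀ i, Fintype (Y i)]

/-- The law of the outcome with the auxiliaries and inputs selected by the marks `z`. -/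
noncomputable def selectedLaw {D : DecodingOrder N} (P : Network X Y) (A : Auxiliary X Y U D)
    (z : Marks X U) : PMF (Outcome X Y U) :=
  chainLaw fun i past => (P i (fun j hj => (past j hj).1) (fun j hj => (past j hj).2.1)).map fun y =>
    (selectX A z i y (pastUBar D i past), y, selectU A z i y (pastUBar D i past))

open Classical in
theorem selectedLaw_apply {D : DecodingOrder N} (P : Network X Y) (A : Auxiliary X Y U D)
    (z : Marks X U) (ω : Outcome X Y U) :
    selectedLaw P A z ω = if Selected A z ω then
      ∏ i, P i (fun j _ => Outcome.x ω j) (fun j _ => Outcome.y ω j) (Outcome.y ω i) else 0 := by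
  unfold Selected
  rw [← prod_ite_forall]
  change ∏ i, ((P i (fun j _ => (ω j).1) fun j _ => (ω j).2.1).map fun y =>
    (selectX A z i y (Outcome.uBar ω D i (D.unique i)), y,
      selectU A z i y (Outcome.uBar ω D i (D.unique i)))) (ω i) = _
  refine prod_congr rfl fun i _ => ?_
  rw [map_apply_of_leftInverse _ _ (fun c => c.2.1) fun _ => rfl]
  simp [Prod.ext_iff, and_comm]

open Classical in
/-- The scheme with fixed marks fails at most as often as the selected outcome is bad. -/
theorem schemeLaw_markedScheme_le {D : DecodingOrder N} (P : Network X Y) (A : Auxiliary X Y U D)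
    (p : PMF (Outcome X Y U)) (z : Marks X U) (E : Set ((∀ i, X i) × (∀ i, Y i))) :
    (schemeLaw P (markedScheme p A z)).toOuterMeasure
        {s | ((fun i => (s i).1), (fun i => (s i).2)) ∈ E}
      ≤ ∑ ω, if (Outcome.x ω, Outcome.y ω) ∈ E ∨ DecodingError p D z ω
          then selectedLaw P A z ω else 0 := by
  set σ := schemeLaw P (markedScheme p A z)
  let F : Set (∀ i, X i × Y i) := {s | ((fun i => (s i).1), (fun i => (s i).2)) ∈ E}
  let good : Outcome X Y U → Prop := fun ω =>
    ¬((Outcome.x ω, Outcome.y ω) ∈ E ∨ DecodingError p D z ω)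
  let φ : Outcome X Y U → ∀ i, X i × Y i := fun ω i => (Outcome.x ω i, Outcome.y ω i)
  have hσ : (∑ s with s ∈ F, σ s) + ∑ s with s ∉ F, σ s = 1 := by
    rw [sum_filter_add_sum_filter_not, sum_pmf]
  have hτ : (∑ ω with ¬good ω, selectedLaw P A z ω) + ∑ ω with good ω, selectedLaw P A z ω = 1 := by
    rw [add_comm, sum_filter_add_sum_filter_not, sum_pmf]
  -- Both laws have mass one, so bounding the good mass suffices: good selected outcomes project,
  -- with equal mass, into the complement of `F`.
  have hgood : ∑ ω with good ω, selectedLaw P A z ω ≤ ∑ s with s ∉ F, σ s := by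
    have h1 : ∑ ω with good ω, selectedLaw P A z ω
        = ∑ ω with good ω ∧ Selected A z ω, σ (φ ω) := by
      rw [← filter_filter, sum_filter (p := Selected A z)]
      refine sum_congr rfl fun ω hω => ?_
      rw [selectedLaw_apply]
      split_ifs with hs
      · have hg : ¬DecodingError p D z ω := fun h => (mem_filter.1 hω).2 (Or.inr h)
        rw [schemeLaw_apply, if_pos fun i => (hs.eq_of_not_decodingError hg i).1]
      · rfl
    -- Projection loses nothing: with the marks fixed and no decoding error, `U_i` is a function of
    -- `Y_i`.
    have hinj : Set.InjOn φ (univ.filter fun ω => good ω ∧ Selected A z ω) := by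
      intro ω hω ω' hω' h
      simp only [coe_filter, mem_univ, true_and, Set.mem_ofPred_eq] at hω hω'
      have hg : ¬DecodingError p D z ω := fun h => hω.1 (Or.inr h)
      have hg' : ¬DecodingError p D z ω' := fun h => hω'.1 (Or.inr h)
      funext i
      have hx : Outcome.x ω i = Outcome.x ω' i := (Prod.ext_iff.1 (congrFun h i)).1
      have hy : Outcome.y ω i = Outcome.y ω' i := (Prod.ext_iff.1 (congrFun h i)).2
      have hu : Outcome.u ω i = Outcome.u ω' i := by
        rw [← (hω.2.eq_of_not_decodingError hg i).2, ← (hω'.2.eq_of_not_decodingError hg' i).2, hy]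
      exact Prod.ext hx (Prod.ext hy hu)
    rw [h1, ← sum_image (f := fun s => σ s) hinj]
    refine sum_le_sum_of_subset fun s hs => ?_
    obtain ⟨ω, hω, rfl⟩ := mem_image.1 hs
    simp only [mem_filter, mem_univ, true_and] at hω ⊢
    exact fun h => hω.1 (Or.inl h)
  have hF : σ.toOuterMeasure F = ∑ s with s ∈ F, σ s := by
    rw [PMF.toOuterMeasure_apply_fintype, sum_filter]
    rfl
  have hbad : (∑ ω, if (Outcome.x ω, Outcome.y ω) ∈ E ∨ DecodingError p D z ω
      then selectedLaw P A z ω else 0) = ∑ ω with ¬good ω, selectedLaw P A z ω := by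
    rw [sum_filter]
    exact sum_congr rfl fun ω _ => by simp only [good, not_not]
  change σ.toOuterMeasure F ≤ _
  rw [hF, hbad]
  have hfin : ∑ s with s ∉ F, σ s ≠ ∞ := ne_top_of_le_ne_top ENNReal.one_ne_top (hσ ▸ le_add_self)
  rw [← ENNReal.add_le_add_iff_right hfin, hσ, ← hτ]
  gcongr

end Coupling

end ADN

/-! ### Averaging over the marks -/

namespace ADN

open MeasureTheory ProbabilityTheory Finset
open scoped ENNReal

section Integration

variable {N : ℕ} {X Y U : Fin N → Type*} [∀ i, Fintype (X i)] [∀ i, Fintype (U i)]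

/-- The law of the marks at one node. -/
noncomputable def nodeMeasure (X U : Fin N → Type*) [∀ i, Fintype (X i)] [∀ i, Fintype (U i)]
    (l : Fin N) : Measure ((U l → ℝ) × (X l → ℝ)) :=
  (raceMeasure (U l)).prod (raceMeasure (X l))

instance (l : Fin N) : IsProbabilityMeasure (nodeMeasure X U l) := by
  unfold nodeMeasure; infer_instance

/-- The law of the marks. -/
noncomputable def marksMeasure (X U : Fin N → Type*) [∀ i, Fintype (X i)] [∀ i, Fintype (U i)] :
    Measure (Marks X U) :=
  Measure.pi (nodeMeasure X U)

instance : IsProbabilityMeasure (marksMeasure X U) := by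
  unfold marksMeasure; infer_instance

variable {D : DecodingOrder N} (A : Auxiliary X Y U D) (ω : Outcome X Y U)

/-- The conditional probability of `U_l` in the outcome `ω`. -/
noncomputable def uProb (l : Fin N) : ℝ≥0∞ :=
  A.pU l (Outcome.y ω l) (Outcome.uBar ω D l (D.unique l)) (Outcome.u ω l)

/-- The conditional probability of `X_l` in the outcome `ω`. -/
noncomputable def xProb (l : Fin N) : ℝ≥0∞ :=
  A.pX l (Outcome.y ω l) (Outcome.u ω l) (Outcome.uBar ω D l (D.unique l)) (Outcome.x ω l)

/-- The marks at the node `l` that select `U_l` in the outcome `ω`. -/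
def uWins (l : Fin N) : Set (U l → ℝ) :=
  {z | Wins (fun v => (A.pU l (Outcome.y ω l) (Outcome.uBar ω D l (D.unique l)) v).toReal) z
    (Outcome.u ω l)}

/-- The marks at the node `l` that select `X_l` in the outcome `ω`. -/
def xWins (l : Fin N) : Set (X l → ℝ) :=
  {z | Wins (fun v => (A.pX l (Outcome.y ω l) (Outcome.u ω l)
    (Outcome.uBar ω D l (D.unique l)) v).toReal) z (Outcome.x ω l)}

theorem measurableSet_uWins (l : Fin N) : MeasurableSet (uWins A ω l) := measurableSet_wins _ _

theorem measurableSet_xWins (l : Fin N) : MeasurableSet (xWins A ω l) := measurableSet_wins _ _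

theorem xWins_le (l : Fin N) : raceMeasure (X l) (xWins A ω l) ≤ xProb A ω l := by
  refine (raceMeasure_wins_le (fun _ => ENNReal.toReal_nonneg) (sum_pmf_toReal _) _).trans ?_
  rw [ENNReal.ofReal_toReal (PMF.apply_ne_top _ _)]
  rfl

theorem uWins_le (l : Fin N) : raceMeasure (U l) (uWins A ω l) ≤ uProb A ω l := by
  refine (raceMeasure_wins_le (fun _ => ENNReal.toReal_nonneg) (sum_pmf_toReal _) _).trans ?_
  rw [ENNReal.ofReal_toReal (PMF.apply_ne_top _ _)]
  rfl

theorem nodeMeasure_wins_le (l : Fin N) :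
    nodeMeasure X U l (uWins A ω l ×ˢ xWins A ω l) ≤ uProb A ω l * xProb A ω l := by
  rw [nodeMeasure, Measure.prod_prod]
  exact mul_le_mul' (uWins_le A ω l) (xWins_le A ω l)

/-- Passing from the chosen winner to the event of winning enlarges it in case of ties, but makes it
a product over the nodes. Only upper bounds are needed. -/
theorem Selected.mem_wins [∀ i, Nonempty (X i)] [∀ i, Nonempty (U i)] {z : Marks X U}
    (h : Selected A z ω) (l : Fin N) : z l ∈ uWins A ω l ×ˢ xWins A ω l := by
  obtain ⟨h1, h2⟩ := h l
  have hx := winner_wins (fun v => (A.pX l (Outcome.y ω l)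
    (selectU A z l (Outcome.y ω l) (Outcome.uBar ω D l (D.unique l)))
    (Outcome.uBar ω D l (D.unique l)) v).toReal) (z l).2
  rw [show winner _ _ = Outcome.x ω l from h2, h1] at hx
  have hu := winner_wins (fun v => (A.pU l (Outcome.y ω l)
    (Outcome.uBar ω D l (D.unique l)) v).toReal) (z l).1
  rw [show winner _ _ = Outcome.u ω l from h1] at hu
  exact ⟨hu, hx⟩

/-- The rival count involves only the marks for `U_l`; the independent marks for `X_l` contribute
the factor `xProb`. -/
theorem lintegral_nodeMeasure_rivals_le (l : Fin N) {q : U l → ℝ} (hq : ∀ v, 0 ≤ q v)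
    (hq1 : ∑ v, q v ≤ 1) (hu : 0 < q (Outcome.u ω l)) :
    ∫⁻ ξ, (uWins A ω l ×ˢ xWins A ω l).indicator 1 ξ
        * ((rivals q ξ.1 (Outcome.u ω l)).card : ℝ≥0∞) ∂nodeMeasure X U l
      ≤ uProb A ω l * xProb A ω l
        * ENNReal.ofReal ((uProb A ω l).toReal / q (Outcome.u ω l)) := by
  have h : ∀ ξ : (U l → ℝ) × (X l → ℝ),
      (uWins A ω l ×ˢ xWins A ω l).indicator (1 : (U l → ℝ) × (X l → ℝ) → ℝ≥0∞) ξ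
        * ((rivals q ξ.1 (Outcome.u ω l)).card : ℝ≥0∞)
      = ((uWins A ω l).indicator 1 ξ.1 * ((rivals q ξ.1 (Outcome.u ω l)).card : ℝ≥0∞))
        * (xWins A ω l).indicator 1 ξ.2 := by
    intro ξ
    by_cases h1 : ξ.1 ∈ uWins A ω l <;> by_cases h2 : ξ.2 ∈ xWins A ω l <;>
      simp [h1, h2]
  simp_rw [h]
  have hm : Measurable fun z => (uWins A ω l).indicator (1 : (U l → ℝ) → ℝ≥0∞) z
      * ((rivals q z (Outcome.u ω l)).card : ℝ≥0∞) :=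
    (measurable_one.indicator (measurableSet_uWins A ω l)).mul (measurable_card_rivals q _)
  rw [nodeMeasure, lintegral_prod_mul hm.aemeasurable
    (measurable_one.indicator (measurableSet_xWins A ω l)).aemeasurable,
    lintegral_indicator_one (measurableSet_xWins A ω l)]
  have h1 := lintegral_wins_mul_card_rivals_le (fun _ => ENNReal.toReal_nonneg)
    (sum_pmf_toReal (A.pU l (Outcome.y ω l) (Outcome.uBar ω D l (D.unique l)))) hq hq1 hu
  rw [ENNReal.ofReal_toReal (PMF.apply_ne_top _ _)] at h1
  refine (mul_le_mul' h1 (xWins_le A ω l)).trans (le_of_eq ?_)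
  rw [uProb]
  ring

variable [∀ i, Fintype (Y i)] (p : PMF (Outcome X Y U)) (i : Fin N)

theorem measurable_layerWeight (j : Fin (D.d i)) (y : Y i) (past : ∀ l, l < j → U (D.a i l))
    (k : Fin (D.d i)) (fut : ∀ l, k < l → U (D.a i l)) (v : U (D.a i k)) :
    Measurable fun z : Marks X U => layerWeight p D z i j y past k fut v := by
  unfold layerWeight
  split_ifs
  · exact measurable_const
  · exact measurable_const
  · have h : Measurable fun z : Marks X U =>
        ((rivals (layerProb p D i j y past k fut) (z (D.a i k)).1 v).card : ℝ) := by
      have := ((measurable_card_rivals (layerProb p D i j y past k fut) v).comp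
        ((measurable_pi_apply (D.a i k)).fst : Measurable fun z : Marks X U =>
          (z (D.a i k)).1)).ennreal_toReal
      simpa [Function.comp_def] using this
    exact ((h.add_const 1).inv).mul_const _
  · exact measurable_const

theorem measurable_decodeWeight (j : Fin (D.d i)) (y : Y i)
    (past : ∀ l, l < j → U (D.a i l)) (v : U (D.a i j)) :
    Measurable fun z : Marks X U => decodeWeight p D z i j y past v := by
  unfold decodeWeight
  refine Finset.measurable_sum _ fun s _ => ?_
  split_ifs
  · exact Finset.measurable_prod _ fun k _ => measurable_layerWeight _ _ _ _ _ _ _ _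
  · exact measurable_const

/-- Ranks enter only for `k > j`, and these sit at nodes other than `a_{i,j}` by injectivity. Hence
the weights are fixed while the marks they race with are integrated out. -/
theorem decodeWeight_update (z : Marks X U) (j : Fin (D.d i))
    (t : (U (D.a i j) → ℝ) × (X (D.a i j) → ℝ))
    (y : Y i) (past : ∀ l, l < j → U (D.a i l)) :
    decodeWeight p D (Function.update z (D.a i j) t) i j y past = decodeWeight p D z i j y past := by
  classical
  funext v
  unfold decodeWeight
  refine sum_congr rfl fun s _ => ?_
  congr 1
  refine prod_congr rfl fun k _ => ?_
  unfold layerWeight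
  split_ifs
  · rfl
  · rfl
  · rename_i h2
    rw [Function.update_of_ne fun h => h2.ne' (D.a_injective i h)]
  · rfl

/-- The rivals of the true auxiliary `Ū_{i,j}` when it is decoded after correct decodings. -/
noncomputable def stepRivals (z : Marks X U) (j : Fin (D.d i)) : Finset (U (D.a i j)) :=
  rivals (decodeWeight p D z i j (Outcome.y ω i) fun l _ => Outcome.u ω (D.a i l))
    (z (D.a i j)).1 (Outcome.u ω (D.a i j))

theorem measurableSet_stepRivals_nonempty (j : Fin (D.d i)) :
    MeasurableSet {z : Marks X U | (stepRivals (D := D) ω p i z j).Nonempty} := by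
  have h : {z : Marks X U | (stepRivals (D := D) ω p i z j).Nonempty} = ⋃ v : U (D.a i j),
      {_z : Marks X U | v ≠ Outcome.u ω (D.a i j)} ∩ {z : Marks X U |
        decodeWeight p D z i j (Outcome.y ω i) (fun l _ => Outcome.u ω (D.a i l))
            (Outcome.u ω (D.a i j)) / (z (D.a i j)).1 (Outcome.u ω (D.a i j))
          ≤ decodeWeight p D z i j (Outcome.y ω i) (fun l _ => Outcome.u ω (D.a i l)) v
            / (z (D.a i j)).1 v} := by
    ext z
    simp [stepRivals, rivals, Finset.Nonempty]
  have hz : ∀ v, Measurable fun z : Marks X U => (z (D.a i j)).1 v := fun v =>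
    (measurable_pi_apply v).comp (measurable_pi_apply (D.a i j)).fst
  rw [h]
  exact MeasurableSet.iUnion fun v => (MeasurableSet.const _).inter (measurableSet_le
    ((measurable_decodeWeight _ _ _ _ _ _).div (hz _))
    ((measurable_decodeWeight _ _ _ _ _ _).div (hz _)))

/-- The value of `layerProb` along the outcome `ω`. -/
noncomputable def trueLayer (j k : Fin (D.d i)) : U (D.a i k) → ℝ :=
  layerProb p D i j (Outcome.y ω i) (fun l _ => Outcome.u ω (D.a i l)) k
    fun l _ => Outcome.u ω (D.a i l)

variable {p}

theorem trueLayer_eq (j k : Fin (D.d i)) (v : U (D.a i k)) :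
    trueLayer ω p i j k v = condProb p (fun ω => Outcome.u ω (D.a i k))
      (fun ω => (Outcome.uBar ω D i (Icc j k)ᶜ, Outcome.y ω i)) v
      (Outcome.uBar ω D i (Icc j k)ᶜ, Outcome.y ω i) := by
  rw [trueLayer, layerProb, mixedUBar_uBar]

variable {ω}

theorem trueLayer_pos (hω : p ω ≠ 0) (j k : Fin (D.d i)) :
    0 < trueLayer ω p i j k (Outcome.u ω (D.a i k)) := by
  rw [trueLayer_eq]
  exact condProb_pos p (fun ω => Outcome.u ω (D.a i k)) _ hω

/-- The left side is the single term of the true tuple in the nonnegative sum; its factors before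
`j` equal one. -/
theorem prod_trueLayer_le_decodeWeight (z : Marks X U) (j : Fin (D.d i)) :
    trueLayer ω p i j j (Outcome.u ω (D.a i j))
        * ∏ k ∈ Ioi j, ((((rivals (trueLayer ω p i j k) (z (D.a i k)).1
            (Outcome.u ω (D.a i k))).card : ℝ) + 1)⁻¹
          * (Real.log (Fintype.card (U (D.a i k))) + 1)⁻¹)
      ≤ decodeWeight p D z i j (Outcome.y ω i) (fun l _ => Outcome.u ω (D.a i l))
          (Outcome.u ω (D.a i j)) := by
  refine le_trans (le_of_eq ?_) (prod_layerWeight_le_decodeWeight p D z i j (Outcome.y ω i)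
    (fun l _ => Outcome.u ω (D.a i l)) fun k => Outcome.u ω (D.a i k))
  rw [← prod_subset (subset_univ (Ici j)), ← Ioi_insert, prod_insert (by simp)]
  · congr 1
    · simp [layerWeight, trueLayer]
    · refine prod_congr rfl fun k hk => ?_
      have hk := mem_Ioi.1 hk
      simp [layerWeight, trueLayer, hk, hk.not_gt]
  · intro k _ hk
    simp [layerWeight, not_le.1 (mem_Ici.not.1 hk)]

end Integration

end ADN

/-! ### The error probability of one decoding step -/

namespace ADN

open MeasureTheory ProbabilityTheory Finset
open scoped ENNReal

section StepError

variable {N : ℕ} {X Y U : Fin N → Type*} [∀ i, Fintype (X i)] [∀ i, Fintype (Y i)]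
  [∀ i, Fintype (U i)] {D : DecodingOrder N} (A : Auxiliary X Y U D) {ω : Outcome X Y U}
  {p : PMF (Outcome X Y U)} (i : Fin N)

/-- The ratio of the law with which `Ū_{i,k}` is encoded to the one with which it is decoded. -/
noncomputable def layerRatio (ω : Outcome X Y U) (p : PMF (Outcome X Y U)) (j k : Fin (D.d i)) : ℝ :=
  (uProb A ω (D.a i k)).toReal / trueLayer ω p i j k (Outcome.u ω (D.a i k))

theorem layerRatio_nonneg (hω : p ω ≠ 0) (j k : Fin (D.d i)) : 0 ≤ layerRatio A i ω p j k :=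
  div_nonneg ENNReal.toReal_nonneg (trueLayer_pos i hω j k).le

/-- The normalized rank of the true `Ū_{i,k}` among its rivals. -/
noncomputable def layerRank (ω : Outcome X Y U) (p : PMF (Outcome X Y U)) (j k : Fin (D.d i))
    (ξ : (U (D.a i k) → ℝ) × (X (D.a i k) → ℝ)) : ℝ :=
  ((rivals (trueLayer ω p i j k) ξ.1 (Outcome.u ω (D.a i k))).card + 1)
    * (Real.log (Fintype.card (U (D.a i k))) + 1)

theorem ofReal_layerRank (j k : Fin (D.d i)) (ξ : (U (D.a i k) → ℝ) × (X (D.a i k) → ℝ)) :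
    ENNReal.ofReal (layerRank i ω p j k ξ)
      = ((rivals (trueLayer ω p i j k) ξ.1 (Outcome.u ω (D.a i k))).card + 1)
        * ENNReal.ofReal (Real.log (Fintype.card (U (D.a i k))) + 1) := by
  rw [layerRank, ENNReal.ofReal_mul (by positivity),
    ENNReal.ofReal_add (by positivity) zero_le_one, ENNReal.ofReal_natCast, ENNReal.ofReal_one]

theorem measurable_ofReal_layerRank (j k : Fin (D.d i)) :
    Measurable fun ξ => ENNReal.ofReal (layerRank i ω p j k ξ) := by
  simp_rw [ofReal_layerRank]
  exact (((measurable_card_rivals _ _).comp measurable_fst).add_const 1).mul_const _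

/-- The rank is the rival count plus one: the matching bound turns the count into `layerRatio`, and
the one contributes the probability of winning. -/
theorem lintegral_wins_mul_layerRank_le (hω : p ω ≠ 0) (j k : Fin (D.d i)) :
    ∫⁻ ξ, (uWins A ω (D.a i k) ×ˢ xWins A ω (D.a i k)).indicator 1 ξ
        * ENNReal.ofReal (layerRank i ω p j k ξ) ∂nodeMeasure X U (D.a i k)
      ≤ uProb A ω (D.a i k) * xProb A ω (D.a i k)
        * ENNReal.ofReal ((Real.log (Fintype.card (U (D.a i k))) + 1)
          * (layerRatio A i ω p j k + 1)) := by
  set W := uWins A ω (D.a i k) ×ˢ xWins A ω (D.a i k)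
  have hW : MeasurableSet W :=
    (measurableSet_uWins A ω (D.a i k)).prod (measurableSet_xWins A ω (D.a i k))
  set R := fun ξ : (U (D.a i k) → ℝ) × (X (D.a i k) → ℝ) =>
    ((rivals (trueLayer ω p i j k) ξ.1 (Outcome.u ω (D.a i k))).card : ℝ≥0∞)
  have hR : Measurable R := (measurable_card_rivals _ _).comp measurable_fst
  have h : ∀ ξ, W.indicator 1 ξ * ENNReal.ofReal (layerRank i ω p j k ξ)
      = (W.indicator 1 ξ * R ξ + W.indicator 1 ξ)
        * ENNReal.ofReal (Real.log (Fintype.card (U (D.a i k))) + 1) := by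
    intro ξ
    rw [ofReal_layerRank]
    ring
  simp_rw [h]
  have hq : ∀ v, 0 ≤ trueLayer ω p i j k v := fun v => condProb_nonneg _ _ _ _ _
  have hq1 : ∑ v, trueLayer ω p i j k v ≤ 1 := sum_condProb_le_one _ _ _ _
  have h1 := lintegral_nodeMeasure_rivals_le A ω (D.a i k) hq hq1 (trueLayer_pos i hω j k)
  have h2 := nodeMeasure_wins_le A ω (D.a i k)
  have hL := logCard_add_one_pos (U (D.a i k))
  rw [lintegral_mul_const' _ _ ENNReal.ofReal_ne_top,
    lintegral_add_right _ (measurable_one.indicator hW), lintegral_indicator_one hW]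
  refine (mul_le_mul_left (add_le_add h1 h2) _).trans (le_of_eq ?_)
  rw [ENNReal.ofReal_mul hL.le, ENNReal.ofReal_add (layerRatio_nonneg A i hω j k) zero_le_one,
    ENNReal.ofReal_one, layerRatio]
  ring

theorem ratio_decodeWeight_le (hω : p ω ≠ 0) (z : Marks X U) (j : Fin (D.d i)) :
    0 < decodeWeight p D z i j (Outcome.y ω i) (fun l _ => Outcome.u ω (D.a i l))
        (Outcome.u ω (D.a i j)) ∧
    ENNReal.ofReal ((uProb A ω (D.a i j)).toReal
        / decodeWeight p D z i j (Outcome.y ω i) (fun l _ => Outcome.u ω (D.a i l))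
          (Outcome.u ω (D.a i j)))
      ≤ ENNReal.ofReal (layerRatio A i ω p j j)
        * ∏ k ∈ Ioi j, ENNReal.ofReal (layerRank i ω p j k (z (D.a i k))) := by
  have h := prod_trueLayer_le_decodeWeight i (p := p) (ω := ω) z j
  have hq := trueLayer_pos i hω j j
  have hr : ∀ k, 0 < layerRank i ω p j k (z (D.a i k)) := fun k => by
    have := logCard_add_one_pos (U (D.a i k))
    unfold layerRank
    positivity
  have e : ∀ k, (((rivals (trueLayer ω p i j k) (z (D.a i k)).1
            (Outcome.u ω (D.a i k))).card : ℝ) + 1)⁻¹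
          * (Real.log (Fintype.card (U (D.a i k))) + 1)⁻¹
        = (layerRank i ω p j k (z (D.a i k)))⁻¹ := fun k => by
    rw [layerRank, mul_inv]
  simp_rw [e] at h
  rw [prod_inv_distrib] at h
  have hpr : 0 < ∏ k ∈ Ioi j, layerRank i ω p j k (z (D.a i k)) := prod_pos fun k _ => hr k
  have hpos := mul_pos hq (inv_pos.2 hpr)
  refine ⟨hpos.trans_le h, ?_⟩
  rw [← ENNReal.ofReal_prod_of_nonneg fun k _ => (hr k).le,
    ← ENNReal.ofReal_mul (layerRatio_nonneg A i hω j j)]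
  refine ENNReal.ofReal_le_ofReal ?_
  refine (div_le_div_of_nonneg_left ENNReal.toReal_nonneg hpos h).trans (le_of_eq ?_)
  rw [layerRatio]
  field_simp

/-- Integrating out the marks of the node being decoded. -/
theorem lintegral_update_le (hω : p ω ≠ 0) (x : Marks X U) (j : Fin (D.d i)) :
    ∫⁻ t, (∏ l, (uWins A ω l ×ˢ xWins A ω l).indicator 1 (Function.update x (D.a i j) t l))
        * {z : Marks X U | (stepRivals (D := D) ω p i z j).Nonempty}.indicator (1 : Marks X U → ℝ≥0∞)
          (Function.update x (D.a i j) t) ∂nodeMeasure X U (D.a i j)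
      ≤ (∏ l ∈ univ.erase (D.a i j), (uWins A ω l ×ˢ xWins A ω l).indicator 1 (x l))
        * (uProb A ω (D.a i j) * xProb A ω (D.a i j)
          * (ENNReal.ofReal (layerRatio A i ω p j j)
            * ∏ k ∈ Ioi j, ENNReal.ofReal (layerRank i ω p j k (x (D.a i k))))) := by
  set a := D.a i j
  set Q := decodeWeight p D x i j (Outcome.y ω i) fun l _ => Outcome.u ω (D.a i l)
  have hQ := ratio_decodeWeight_le A i hω x j
  have h : ∀ t, (∏ l, (uWins A ω l ×ˢ xWins A ω l).indicator 1 (Function.update x a t l))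
        * {z : Marks X U | (stepRivals (D := D) ω p i z j).Nonempty}.indicator (1 : Marks X U → ℝ≥0∞)
          (Function.update x a t)
      ≤ (∏ l ∈ univ.erase a, (uWins A ω l ×ˢ xWins A ω l).indicator 1 (x l))
        * ((uWins A ω a ×ˢ xWins A ω a).indicator 1 t
          * ((rivals Q t.1 (Outcome.u ω a)).card : ℝ≥0∞)) := by
    intro t
    rw [← mul_prod_erase univ _ (mem_univ a), Function.update_self, mul_comm (Set.indicator _ 1 t),
      mul_assoc]
    refine mul_le_mul' (le_of_eq (prod_congr rfl fun l hl => ?_)) (mul_le_mul' le_rfl ?_)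
    · rw [Function.update_of_ne (ne_of_mem_erase hl)]
    · have hs : stepRivals (D := D) ω p i (Function.update x a t) j
          = rivals Q t.1 (Outcome.u ω a) := by
        rw [stepRivals, decodeWeight_update, Function.update_self]
      by_cases hne : (rivals Q t.1 (Outcome.u ω a)).Nonempty
      · rw [Set.indicator_of_mem (by simpa [hs] using hne)]
        rw [Pi.one_apply]
        -- A nonempty rival set has at least one element: the error indicator is bounded by the
        -- rival count, whose mean is known.
        exact_mod_cast hne.card_pos
      · rw [Set.indicator_of_notMem (by simpa [hs] using hne)]
        exact zero_le
  refine (lintegral_mono h).trans ?_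
  have hm : Measurable fun t : (U a → ℝ) × (X a → ℝ) =>
      (uWins A ω a ×ˢ xWins A ω a).indicator (1 : (U a → ℝ) × (X a → ℝ) → ℝ≥0∞) t
        * ((rivals Q t.1 (Outcome.u ω a)).card : ℝ≥0∞) :=
    (measurable_one.indicator ((measurableSet_uWins A ω a).prod (measurableSet_xWins A ω a))).mul
      ((measurable_card_rivals _ _).comp measurable_fst)
  rw [lintegral_const_mul _ hm]
  refine mul_le_mul' le_rfl ((lintegral_nodeMeasure_rivals_le A ω a
    (fun v => decodeWeight_nonneg _ _ _ _ _ _ _ v) (sum_decodeWeight_le_one _ _ _ _ _ _ _)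
    hQ.1).trans ?_)
  exact mul_le_mul' le_rfl hQ.2

/-- The marks at `a_{i,j}` are integrated first, with the weights frozen, leaving a ratio times
ranks. Each rank depends on the marks of one node, distinct for distinct `k`, so the rest factors
over the nodes. -/
theorem stepError_le (hω : p ω ≠ 0) (j : Fin (D.d i)) :
    marksMeasure X U (Set.univ.pi (fun l => uWins A ω l ×ˢ xWins A ω l)
        ∩ {z | (stepRivals (D := D) ω p i z j).Nonempty})
      ≤ (∏ l, uProb A ω l * xProb A ω l) * (ENNReal.ofReal (layerRatio A i ω p j j)
        * ∏ k ∈ Ioi j, ENNReal.ofReal ((Real.log (Fintype.card (U (D.a i k))) + 1)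
          * (layerRatio A i ω p j k + 1))) := by
  classical
  set W := fun l => uWins A ω l ×ˢ xWins A ω l
  have hW : ∀ l, MeasurableSet (W l) := fun l =>
    (measurableSet_uWins A ω l).prod (measurableSet_xWins A ω l)
  set B := {z : Marks X U | (stepRivals (D := D) ω p i z j).Nonempty}
  have hB : MeasurableSet B := measurableSet_stepRivals_nonempty ω p i j
  have hf : Measurable fun z : Marks X U =>
      (∏ l, (W l).indicator (1 : (U l → ℝ) × (X l → ℝ) → ℝ≥0∞) (z l)) * B.indicator 1 z :=
    (Finset.measurable_prod _ fun l _ =>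
      (measurable_one.indicator (hW l)).comp (measurable_pi_apply l)).mul
      (measurable_one.indicator hB)
  have e1 : ∀ z : Marks X U, (Set.univ.pi W ∩ B).indicator (1 : Marks X U → ℝ≥0∞) z
      = (∏ l, (W l).indicator (1 : (U l → ℝ) × (X l → ℝ) → ℝ≥0∞) (z l)) * B.indicator 1 z := by
    intro z
    by_cases h1 : ∀ l, z l ∈ W l
    · rw [prod_eq_one fun l _ => Set.indicator_of_mem (h1 l) _, one_mul]
      by_cases h2 : z ∈ B <;> simp [Set.mem_pi, h1, h2]
    · push Not at h1
      obtain ⟨l, hl⟩ := h1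
      rw [prod_eq_zero (mem_univ l) (Set.indicator_of_notMem hl _), zero_mul,
        Set.indicator_of_notMem fun h => hl (h.1 l trivial)]
  rw [← lintegral_indicator_one ((MeasurableSet.univ_pi hW).inter hB), lintegral_congr e1,
    marksMeasure, lintegral_pi_update (nodeMeasure X U) (D.a i j) hf]
  refine (lintegral_mono fun x => lintegral_update_le A i hω x j).trans ?_
  let c : ℝ≥0∞ := uProb A ω (D.a i j) * xProb A ω (D.a i j)
    * ENNReal.ofReal (layerRatio A i ω p j j)
  let R : ∀ k : Fin (D.d i), Marks X U → ℝ≥0∞ := fun k z =>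
    ENNReal.ofReal (layerRank i ω p j k (z (D.a i k)))
  -- The factor of node `l`, including the ranks located there. Updating the zero family avoids a
  -- cast along `D.a i k = l`; its other coordinates are never read.
  let g : ∀ l, (U l → ℝ) × (X l → ℝ) → ℝ≥0∞ := fun l ξ =>
    (if l = D.a i j then c else (W l).indicator 1 ξ)
      * ∏ k ∈ Ioi j with D.a i k = l, R k (Function.update 0 l ξ)
  have hg : ∀ l, Measurable (g l) := by
    intro l
    refine Measurable.mul ?_ (Finset.measurable_prod _ fun k _ => ?_)
    · split_ifs
      · exact measurable_const
      · exact measurable_one.indicator (hW l)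
    · have hu : Measurable fun ξ => Function.update (0 : Marks X U) l ξ := measurable_update _
      exact (measurable_ofReal_layerRank i j k).comp
        ((measurable_pi_apply (D.a i k)).comp hu)
  have e2 : ∀ x : Marks X U, (∏ l ∈ univ.erase (D.a i j), (W l).indicator 1 (x l))
        * (uProb A ω (D.a i j) * xProb A ω (D.a i j)
          * (ENNReal.ofReal (layerRatio A i ω p j j)
            * ∏ k ∈ Ioi j, ENNReal.ofReal (layerRank i ω p j k (x (D.a i k)))))
      = ∏ l, g l (x l) := by
    intro x
    simp only [g]
    rw [prod_mul_distrib]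
    have h1 : ∏ l, ∏ k ∈ Ioi j with D.a i k = l, R k (Function.update 0 l (x l))
        = ∏ k ∈ Ioi j, ENNReal.ofReal (layerRank i ω p j k (x (D.a i k))) := by
      rw [← prod_fiberwise (Ioi j) (D.a i)]
      refine prod_congr rfl fun l _ => prod_congr rfl fun k hk => ?_
      obtain ⟨-, rfl⟩ := mem_filter.1 hk
      simp [R]
    have h2 : ∏ l, (if l = D.a i j then c else (W l).indicator 1 (x l))
        = c * ∏ l ∈ univ.erase (D.a i j), (W l).indicator 1 (x l) := by
      rw [← mul_prod_erase univ _ (mem_univ (D.a i j)), if_pos rfl]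
      congr 1
      exact prod_congr rfl fun l hl => if_neg (ne_of_mem_erase hl)
    rw [h1, h2]
    simp only [c]
    ring
  refine (lintegral_congr e2).trans_le ?_
  rw [lintegral_pi_prod (nodeMeasure X U) hg]
  let L : Fin (D.d i) → ℝ≥0∞ := fun k => ENNReal.ofReal
    ((Real.log (Fintype.card (U (D.a i k))) + 1) * (layerRatio A i ω p j k + 1))
  have h3 : ∀ l, ∫⁻ ξ, g l ξ ∂nodeMeasure X U l
      ≤ (uProb A ω l * xProb A ω l
          * (if l = D.a i j then ENNReal.ofReal (layerRatio A i ω p j j) else 1))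
        * ∏ k ∈ Ioi j with D.a i k = l, L k := by
    intro l
    by_cases hl : l = D.a i j
    · subst hl
      have hemp : (Ioi j).filter (fun k => D.a i k = D.a i j) = ∅ :=
        filter_eq_empty_iff.2 fun k hk h => (mem_Ioi.1 hk).ne' (D.a_injective i h)
      simp [g, hemp, c]
    -- By injectivity a node other than `a_{i,j}` carries at most one rank.
    · rcases ((Ioi j).filter fun k => D.a i k = l).eq_empty_or_nonempty with hemp | ⟨k, hk⟩
      · simp only [g, hemp, prod_empty, mul_one, if_neg hl]
        rw [lintegral_indicator_one (hW l)]
        exact nodeMeasure_wins_le A ω l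
      · obtain ⟨-, rfl⟩ := mem_filter.1 hk
        have hsing : (Ioi j).filter (fun k' => D.a i k' = D.a i k) = {k} :=
          eq_singleton_iff_unique_mem.2 ⟨hk, fun k' hk' => D.a_injective i (mem_filter.1 hk').2⟩
        simp only [g, hsing, prod_singleton, mul_one, if_neg hl, R, Function.update_self]
        exact lintegral_wins_mul_layerRank_le A i hω j k
  refine (prod_le_prod' fun l _ => h3 l).trans (le_of_eq ?_)
  rw [prod_mul_distrib, prod_mul_distrib, prod_ite_eq', if_pos (mem_univ _), prod_fiberwise,
    mul_assoc]

end StepError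

end ADN

/-! ### Union bound and choice of the marks -/

namespace ADN

open MeasureTheory ProbabilityTheory Finset
open scoped ENNReal

section Assembly

variable {N : ℕ} {X Y U : Fin N → Type*} [∀ i, Fintype (X i)] [∀ i, Fintype (Y i)]
  [∀ i, Fintype (U i)] (P : Network X Y) {D : DecodingOrder N} (A : Auxiliary X Y U D)

/-- The second information density is governed by the encoding kernel, so each power of two is an
encoding-to-decoding ratio. The indicator of `k > j` is the one added to a rival count; `j` itself
has no rank. -/
theorem bTerm_eq {ω : Outcome X Y U} (hω : idealLaw P D A ω ≠ 0) (i : Fin N) (j : Fin (D.d i)) :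
    bTerm (idealLaw P D A) D i j ω = layerRatio A i ω (idealLaw P D A) j j
      * ∏ k ∈ Ioi j, ((Real.log (Fintype.card (U (D.a i k))) + 1)
        * (layerRatio A i ω (idealLaw P D A) j k + 1)) := by
  have h : ∀ k, (2 : ℝ) ^ (-infoDensity (idealLaw P D A) (fun ω => Outcome.u ω (D.a i k))
        (fun ω => (Outcome.uBar ω D i (Icc j k)ᶜ, Outcome.y ω i)) ω
      + infoDensity (idealLaw P D A) (fun ω => Outcome.u ω (D.a i k))
        (fun ω => (Outcome.uBar ω D (D.a i k) (D.unique (D.a i k)), Outcome.y ω (D.a i k))) ω)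
      = layerRatio A i ω (idealLaw P D A) j k := by
    intro k
    rw [two_rpow_infoDensity _ _ _ _ hω, condProb_idealLaw_u P D A (D.a i k) hω, layerRatio,
      trueLayer_eq]
    rfl
  rw [bTerm, gammaTerm]
  simp_rw [h]
  rw [← Ioi_insert, prod_insert (by simp), if_neg (lt_irrefl j), add_zero, prod_mul_distrib,
    mul_left_comm]
  congr 2
  exact prod_congr rfl fun k hk => by rw [if_pos (mem_Ioi.1 hk)]

theorem bTerm_nonneg {ω : Outcome X Y U} (hω : idealLaw P D A ω ≠ 0) (i : Fin N)
    (j : Fin (D.d i)) : 0 ≤ bTerm (idealLaw P D A) D i j ω := by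
  rw [bTerm_eq P A hω]
  refine mul_nonneg (layerRatio_nonneg A i hω j j) (prod_nonneg fun k _ => ?_)
  have h1 := logCard_add_one_pos (U (D.a i k))
  have h2 := layerRatio_nonneg A i hω j k
  positivity

theorem stepError_le_bTerm {ω : Outcome X Y U} (hω : idealLaw P D A ω ≠ 0) (i : Fin N)
    (j : Fin (D.d i)) :
    marksMeasure X U (Set.univ.pi (fun l => uWins A ω l ×ˢ xWins A ω l)
        ∩ {z | (stepRivals (D := D) ω (idealLaw P D A) i z j).Nonempty})
      ≤ (∏ l, uProb A ω l * xProb A ω l) * ENNReal.ofReal (bTerm (idealLaw P D A) D i j ω) := by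
  refine (stepError_le A i hω j).trans (le_of_eq ?_)
  have h1 := fun k => logCard_add_one_pos (U (D.a i k))
  have h2 := fun k => layerRatio_nonneg A i hω j k
  rw [bTerm_eq P A hω, ENNReal.ofReal_mul (h2 j), ENNReal.ofReal_prod_of_nonneg fun k _ =>
    mul_nonneg (h1 k).le (add_nonneg (h2 k) zero_le_one)]

theorem marksMeasure_wins_le (ω : Outcome X Y U) :
    marksMeasure X U (Set.univ.pi fun l => uWins A ω l ×ˢ xWins A ω l)
      ≤ ∏ l, uProb A ω l * xProb A ω l := by
  rw [marksMeasure, Measure.pi_pi]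
  exact prod_le_prod' fun l _ => nodeMeasure_wins_le A ω l

/-- The bound of the main theorem in the outcome `ω`. -/
noncomputable def outcomeBound (E : Set ((∀ i, X i) × (∀ i, Y i))) (ω : Outcome X Y U) : ℝ :=
  min (E.indicator (fun _ => (1 : ℝ)) (Outcome.x ω, Outcome.y ω)
    + ∑ i, ∑ j ∈ D.unique i, bTerm (idealLaw P D A) D i j ω) 1

/-- The marks for which the outcome `ω` lies in `E` or is decoded with an error. -/
def badMarks (E : Set ((∀ i, X i) × (∀ i, Y i))) (ω : Outcome X Y U) : Set (Marks X U) :=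
  {z | (Outcome.x ω, Outcome.y ω) ∈ E ∨ DecodingError (idealLaw P D A) D z ω}

theorem decodingError_eq_iUnion (ω : Outcome X Y U) :
    {z : Marks X U | DecodingError (idealLaw P D A) D z ω}
      = ⋃ i, ⋃ j ∈ D.unique i, {z | (stepRivals (D := D) ω (idealLaw P D A) i z j).Nonempty} := by
  ext z
  simp [DecodingError, stepRivals]

theorem measurableSet_badMarks (E : Set ((∀ i, X i) × (∀ i, Y i))) (ω : Outcome X Y U) :
    MeasurableSet (badMarks P A E ω) := by
  have h : badMarks P A E ω = {_z | (Outcome.x ω, Outcome.y ω) ∈ E}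
      ∪ {z : Marks X U | DecodingError (idealLaw P D A) D z ω} := rfl
  rw [h, decodingError_eq_iUnion]
  exact (MeasurableSet.const _).union (MeasurableSet.iUnion fun i =>
    Finset.measurableSet_biUnion _ fun j _ => measurableSet_stepRivals_nonempty ω _ i j)

theorem toReal_mul_outcomeBound_nonneg (E : Set ((∀ i, X i) × (∀ i, Y i))) (ω : Outcome X Y U) :
    0 ≤ (idealLaw P D A ω).toReal * outcomeBound P A E ω := by
  by_cases hω : idealLaw P D A ω = 0
  · simp [hω]
  · exact mul_nonneg ENNReal.toReal_nonneg
      (le_min (add_nonneg (Set.indicator_nonneg (fun _ _ => zero_le_one) _)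
        (sum_nonneg fun i _ => sum_nonneg fun j _ => bTerm_nonneg P A hω i j)) zero_le_one)

theorem marksMeasure_wins_inter_badMarks_le {ω : Outcome X Y U} (hω : idealLaw P D A ω ≠ 0)
    (E : Set ((∀ i, X i) × (∀ i, Y i))) :
    marksMeasure X U (Set.univ.pi (fun l => uWins A ω l ×ˢ xWins A ω l) ∩ badMarks P A E ω)
      ≤ (∏ l, uProb A ω l * xProb A ω l) * ENNReal.ofReal (outcomeBound P A E ω) := by
  set W := Set.univ.pi fun l => uWins A ω l ×ˢ xWins A ω l
  have hB : ∀ i, 0 ≤ ∑ j ∈ D.unique i, bTerm (idealLaw P D A) D i j ω :=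
    fun i => sum_nonneg fun j _ => bTerm_nonneg P A hω i j
  have h1 : marksMeasure X U (W ∩ badMarks P A E ω) ≤ ∏ l, uProb A ω l * xProb A ω l :=
    (measure_mono Set.inter_subset_left).trans (marksMeasure_wins_le A ω)
  -- When the minimum is `1`, winning alone gives the bound. Otherwise the outcome is either in `E`,
  -- which again makes the minimum `1`, or bad only through decoding errors, handled by a union
  -- bound.
  rcases le_total 1 (E.indicator (fun _ => (1 : ℝ)) (Outcome.x ω, Outcome.y ω)
    + ∑ i, ∑ j ∈ D.unique i, bTerm (idealLaw P D A) D i j ω) with h | h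
  · rwa [outcomeBound, min_eq_right h, ENNReal.ofReal_one, mul_one]
  by_cases hE : (Outcome.x ω, Outcome.y ω) ∈ E
  · rw [outcomeBound, Set.indicator_of_mem hE, min_eq_right
      (le_add_of_nonneg_right (sum_nonneg fun i _ => hB i)), ENNReal.ofReal_one, mul_one]
    exact h1
  rw [outcomeBound, min_eq_left h, Set.indicator_of_notMem hE, zero_add]
  have h2 : badMarks P A E ω = {z : Marks X U | DecodingError (idealLaw P D A) D z ω} := by
    ext z
    simp [badMarks, hE]
  rw [h2, decodingError_eq_iUnion, Set.inter_iUnion]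
  simp_rw [Set.inter_iUnion]
  refine (measure_iUnion_fintype_le _ _).trans ?_
  rw [ENNReal.ofReal_sum_of_nonneg fun i _ => hB i, mul_sum]
  refine sum_le_sum fun i _ => ?_
  refine (measure_biUnion_finset_le _ _).trans ?_
  rw [ENNReal.ofReal_sum_of_nonneg fun j _ => bTerm_nonneg P A hω i j, mul_sum]
  exact sum_le_sum fun j _ => stepError_le_bTerm P A hω i j

/-- The probability of the channel outputs of `ω` given the preceding inputs and outputs. -/
noncomputable def channelProb (ω : Outcome X Y U) : ℝ≥0∞ :=
  ∏ i, P i (fun j _ => Outcome.x ω j) (fun j _ => Outcome.y ω j) (Outcome.y ω i)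

theorem idealLaw_eq_channelProb_mul (ω : Outcome X Y U) :
    idealLaw P D A ω = channelProb P ω * ∏ l, uProb A ω l * xProb A ω l := by
  rw [idealLaw_apply, channelProb, ← prod_mul_distrib]
  exact prod_congr rfl fun i _ => mul_assoc _ _ _

theorem channelProb_mul_marksMeasure_le (E : Set ((∀ i, X i) × (∀ i, Y i))) (ω : Outcome X Y U) :
    channelProb P ω * marksMeasure X U
        (Set.univ.pi (fun l => uWins A ω l ×ˢ xWins A ω l) ∩ badMarks P A E ω)
      ≤ ENNReal.ofReal ((idealLaw P D A ω).toReal * outcomeBound P A E ω) := by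
  by_cases hω : idealLaw P D A ω = 0
  -- On a null outcome the error bounds are unavailable, but channel probability times winning
  -- probability is already at most the ideal mass, zero.
  · have h := mul_le_mul_right ((measure_mono Set.inter_subset_left).trans
      (marksMeasure_wins_le A ω) : marksMeasure X U
        (Set.univ.pi (fun l => uWins A ω l ×ˢ xWins A ω l) ∩ badMarks P A E ω) ≤ _)
      (channelProb P ω)
    rw [← idealLaw_eq_channelProb_mul, hω] at h
    exact h.trans zero_le
  · rw [ENNReal.ofReal_mul ENNReal.toReal_nonneg, ENNReal.ofReal_toReal (PMF.apply_ne_top _ _),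
      idealLaw_eq_channelProb_mul, mul_assoc]
    exact mul_le_mul' le_rfl (marksMeasure_wins_inter_badMarks_le P A hω E)

/-- First-moment argument: the mean of the finite sum over the marks is at most the bound, so some
marks do no worse. -/
theorem exists_marks_le (E : Set ((∀ i, X i) × (∀ i, Y i))) :
    ∃ z : Marks X U, ∑ ω, channelProb P ω
        * (Set.univ.pi (fun l => uWins A ω l ×ˢ xWins A ω l) ∩ badMarks P A E ω).indicator 1 z
      ≤ ENNReal.ofReal (expect (idealLaw P D A) (outcomeBound P A E)) := by
  have hm : ∀ ω, MeasurableSet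
      (Set.univ.pi (fun l => uWins A ω l ×ˢ xWins A ω l) ∩ badMarks P A E ω) := fun ω =>
    (MeasurableSet.univ_pi fun l => (measurableSet_uWins A ω l).prod
      (measurableSet_xWins A ω l)).inter (measurableSet_badMarks P A E ω)
  have hG : ∀ ω, Measurable fun z : Marks X U => channelProb P ω
      * (Set.univ.pi (fun l => uWins A ω l ×ˢ xWins A ω l) ∩ badMarks P A E ω).indicator 1 z :=
    fun ω => (measurable_one.indicator (hm ω)).const_mul _
  obtain ⟨z, hz⟩ := exists_le_lintegral (μ := marksMeasure X U)
    (Finset.measurable_sum univ fun ω _ => hG ω).aemeasurable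
  refine ⟨z, hz.trans ?_⟩
  rw [lintegral_finsetSum _ fun ω _ => hG ω, expect, ENNReal.ofReal_sum_of_nonneg]
  · refine sum_le_sum fun ω _ => ?_
    rw [lintegral_const_mul _ (measurable_one.indicator (hm ω)), lintegral_indicator_one (hm ω)]
    exact channelProb_mul_marksMeasure_le P A E ω
  · exact fun ω _ => toReal_mul_outcomeBound_nonneg P A E ω

end Assembly

end ADN

theorem mainTheorem2 {N : ℕ} {X Y U : Fin N → Type*}
    [∀ i, Fintype (X i)] [∀ i, Fintype (Y i)] [∀ i, Fintype (U i)]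
    (P : ADN.Network X Y) (D : ADN.DecodingOrder N) (A : ADN.Auxiliary X Y U D)
    (E : Set ((∀ i, X i) × (∀ i, Y i))) :
    ∃ f : ADN.DeterministicScheme X Y,
      ADN.prob (ADN.schemeLaw P f)
          {z | ((fun i => (z i).1), (fun i => (z i).2)) ∈ E} ≤
        ADN.expect (ADN.idealLaw P D A) (fun ω =>
          min (E.indicator (fun _ => (1 : ℝ)) (ADN.Outcome.x ω, ADN.Outcome.y ω)
            + ∑ i, ∑ j ∈ D.unique i, ADN.bTerm (ADN.idealLaw P D A) D i j ω) 1) := by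
  classical
  -- An ideal law exists, so there is an outcome and the alphabets are nonempty; races need this to
  -- have winners.
  obtain ⟨ω₀, -⟩ := (ADN.idealLaw P D A).support_nonempty
  have : ∀ i, Nonempty (X i) := fun i => ⟨(ω₀ i).1⟩
  have : ∀ i, Nonempty (U i) := fun i => ⟨(ω₀ i).2.2⟩
  obtain ⟨z, hz⟩ := ADN.exists_marks_le P A E
  refine ⟨ADN.markedScheme (ADN.idealLaw P D A) A z,
    ENNReal.toReal_le_of_le_ofReal (Finset.sum_nonneg fun ω _ =>
      ADN.toReal_mul_outcomeBound_nonneg P A E ω)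
      ((ADN.schemeLaw_markedScheme_le P A (ADN.idealLaw P D A) z E).trans (le_trans ?_ hz))⟩
  refine Finset.sum_le_sum fun ω _ => ?_
  split_ifs with hbad
  · rw [ADN.selectedLaw_apply]
    split_ifs with hs
    · have hw : z ∈ Set.univ.pi fun l => ADN.uWins A ω l ×ˢ ADN.xWins A ω l :=
        fun l _ => ADN.Selected.mem_wins A ω hs l
      have hb : z ∈ ADN.badMarks P A E ω := hbad
      rw [Set.indicator_of_mem (Set.mem_inter hw hb)]
      exact (mul_one _).ge
    · exact zero_le
  · exact zero_le
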